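/- Let $HG$ be the Heawood graph, i.e. the bipartite graph with the 14 vertices $u_i, v_i$ ($i\in\mathbb Z/7$) and the 21 edges $u_iv_i$, $u_iv_{i-1}$, $u_iv_{i+2}$ ($i\in\mathbb Z/7$), regarded as a topological space. A plane generic immersion of $HG$ is an immersion (a locally injective continuous map) $f:HG\to\mathbb R^2$ whose multiple points are only finitely many transversal double points between edges: each multiple point has exactly two preimages, both interior points of edges (possibly of the same edge), and near it some local homeomorphism of the plane takes the two branches of $f$ into the two coordinate axes. For a subgraph $H$ of $HG$ let $c(f(H))$ be the number of crossings, i.e. double points, of the restriction $f|_H$, and let $\Gamma_k(HG)$ be the set of all $k$-cycles of $HG$ (subgraphs that are cycles with $k$ edges). Then for every plane generic immersion $f:HG\to\mathbb R^2$, $$\sum_{\gamma\in\Gamma_{6}(HG)}c(f(\gamma))\equiv\sum_{\gamma\in\Gamma_{8}(HG)}c(f(\gamma))\equiv\sum_{\gamma\in\Gamma_{10}(HG)}c(f(\gamma))\equiv 1\pmod 2,$$ $$\sum_{\gamma\in\Gamma_{12}(HG)}c(f(\gamma))\equiv 0\pmod 4,\qquad \sum_{\gamma\in\Gamma_{14}(HG)}c(f(\gamma))\equiv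 0\pmod 2.$$ -/

import Mathlib

open Topology

namespace PlaneGraph

/-- The real plane. -/
abbrev Plane : Type := EuclideanSpace ℝ (Fin 2)

section Realization

variable {V : Type*} [DecidableEq V] {G : SimpleGraph V}

/-- The underlying point set of a subgraph `H`: each vertex `v` is the basis vector `Pi.single v 1`
of `V → ℝ`, and each edge `uv` is the straight segment between the two basis vectors. Distinct
edges of this model meet only in common end vertices. -/
def polyhedron (H : G.Subgraph) : Set (V → ℝ) :=
  {x | (∃ v ∈ H.verts, x = Pi.single v 1) ∨
    ∃ u v, H.Adj u v ∧ x ∈ segment ℝ (Pi.single u (1 : ℝ)) (Pi.single v (1 : ℝ))}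

variable (G) in
/-- The graph `G` (with finitely many vertices, in all uses below) as a topological space, with
the subspace topology from `V → ℝ`. -/
abbrev Realization : Type _ := polyhedron (⊤ : G.Subgraph)

/-- The points of the space `G` that lie in the subgraph `H`. -/
def pointsOf (H : G.Subgraph) : Set (Realization G) := {x | x.1 ∈ polyhedron H}

/-- `x` is a vertex of the topological space `G`. -/
def IsVertexPoint (x : Realization G) : Prop := ∃ v : V, x.1 = Pi.single v 1

/-- The branches of `f` at the points `x` and `y`, with common image `f x = f y`, cross
transversally: some local homeomorphism of the plane, defined near `f x` and mapping it to the
origin, takes the branch at `x` into the first and the branch at `y` into the second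
coordinate axis. -/
def CrossTransversally (f : Realization G → Plane) (x y : Realization G) : Prop :=
  f x = f y ∧ ∃ h : OpenPartialHomeomorph Plane Plane, f x ∈ h.source ∧ h (f x) = 0 ∧
    (∀ᶠ z in 𝓝 x, h (f z) 1 = 0) ∧ (∀ᶠ z in 𝓝 y, h (f z) 0 = 0)

/-- The multiple points of the restriction of `f` to the subgraph `H`. For a plane generic
immersion `f` these are the crossings of `f` restricted to `H`. -/
def crossings (f : Realization G → Plane) (H : G.Subgraph) : Set Plane :=
  {p | ∃ x ∈ pointsOf H, ∃ y ∈ pointsOf H, x ≠ y ∧ f x = p ∧ f y = p}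

/-- Plane generic immersions: immersions (locally injective continuous maps) of `G` into the plane
whose multiple points are only finitely many transversal double points between edges, that is,
double points whose preimages are interior points of edges (possibly of the same edge). -/
structure IsPlaneGenericImmersion (f : Realization G → Plane) : Prop where
  continuous : Continuous f
  locallyInjective : IsLocallyInjective f
  finite_crossings : (crossings f (⊤ : G.Subgraph)).Finite
  double : ∀ x y z, f x = f y → f y = f z → x = y ∨ y = z ∨ x = z
  not_vertex : ∀ x y, x ≠ y → f x = f y → ¬ IsVertexPoint x
  transversal : ∀ x y, x ≠ y → f x = f y → CrossTransversally f x y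

/-- The number of crossings `c(f(H))` of the restriction of `f` to the subgraph `H`. -/
noncomputable def crossingNumber (f : Realization G → Plane) (H : G.Subgraph) : ℕ :=
  (crossings f H).ncard

end Realization

/-- The set of `k`-cycles of `G`: the subgraphs traced out by a closed walk of length `k` that
repeats no vertex and no edge (apart from returning to its start). Each cycle is one subgraph,
whatever its starting point and direction. -/
def kCycles {V : Type*} (G : SimpleGraph V) (k : ℕ) : Set G.Subgraph :=
  {H | ∃ (v : V) (w : G.Walk v v), w.IsCycle ∧ w.length = k ∧ w.toSubgraph = H}

/-- The sum of the crossing numbers `c(f(γ))` over all `k`-cycles `γ` of the finite graph `G`. -/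
noncomputable def sumCrossingNumber {V : Type*} [DecidableEq V] [Finite V] {G : SimpleGraph V}
    (f : Realization G → Plane) (k : ℕ) : ℕ :=
  ∑ γ ∈ (Set.toFinite (kCycles G k)).toFinset, crossingNumber f γ

/-- The adjacency of the vertex `u i = Sum.inl i` with the vertex `v j = Sum.inr j`. -/
def heawoodUV (i j : ZMod 7) : Prop := j = i ∨ j = i - 1 ∨ j = i + 2

/-- The Heawood graph: vertices `u i`, `v i` for `i` modulo `7`, and the 21 edges
`u i v i`, `u i v (i - 1)` and `u i v (i + 2)`. -/
def heawood : SimpleGraph (ZMod 7 ⊕ ZMod 7) where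
  Adj
    | .inl i, .inr j => heawoodUV i j
    | .inr j, .inl i => heawoodUV i j
    | _, _ => False
  symm := ⟨by rintro (a | a) (b | b) h <;> exact h⟩
  loopless := ⟨by rintro (a | a) h <;> exact h⟩

end PlaneGraph

/-! Double counting turns the sum over the `k`-cycles into a sum over the crossings: a crossing of
the edges `e` and `e'` (possibly equal) is counted once for every `k`-cycle through both of them
(`exists_crossing_pairs`). In the Heawood graph the number of such cycles is odd exactly for edges
at distance 2 if `k` is 6, 8 or 10, divisible by 4 if `k = 12`, and even if `k = 14`; this is a
finite check on codes of cycles (`countP_cycleMasks_odd` and its companions). So the last two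
congruences hold crossing by crossing, and the first three all say that the number of crossings
between edges at distance 2 is odd (`odd_sum_farPairs`).

That is an obstruction of van Kampen type. For disjoint edges the function `F(s, t) = e(s) - e'(t)`
on the unit square vanishes exactly at the crossings, and it winds an odd number of times around
each zero by transversality. The parity of the winding is recorded as the sign by which a continuous
square root of `F` changes around the boundary (`holonomy`), so this sign is the parity of the
number of crossings (`holonomy_edges`).

Now multiply over all pairs at distance 2. A side of a square pairs a vertex `x` with an edge `e`,
and each side lies in an even number of these squares (`sideExponent_even`). Hence only squares of
the transports along sides matter, and these are quotients of end values. Normalized by square roots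
of the differences of vertex images, chosen symmetrically in the two vertices, they become signs
independent of `f`; their product is `-1` (`prod_sides_eq_neg_one`). -/

namespace PlaneGraph

open Set

/-! ### Square roots along paths in the punctured plane -/

/-- A continuous nowhere vanishing function on a rectangle has a continuous square root. -/
theorem exists_continuousOn_sqrt {F : ℝ × ℝ → ℂ} {a b c d : ℝ}
    (hF : ContinuousOn F (uIcc a b ×ˢ uIcc c d)) (h0 : ∀ p ∈ uIcc a b ×ˢ uIcc c d, F p ≠ 0) :
    ∃ r : ℝ × ℝ → ℂ, ContinuousOn r (uIcc a b ×ˢ uIcc c d) ∧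
      ∀ p ∈ uIcc a b ×ˢ uIcc c d, r p ^ 2 = F p := by
  -- Retracting the whole plane onto the rectangle makes the domain simply connected, so that the
  -- map lifts through the covering `exp`; half of the logarithm then gives the root.
  let π : ℝ × ℝ → ℝ × ℝ := fun p =>
    (projIcc (a ⊓ b) (a ⊔ b) inf_le_sup p.1, projIcc (c ⊓ d) (c ⊔ d) inf_le_sup p.2)
  have hπ : Continuous π :=
    (continuous_subtype_val.comp (continuous_projIcc.comp continuous_fst)).prodMk
      (continuous_subtype_val.comp (continuous_projIcc.comp continuous_snd))
  have hmem : ∀ p, π p ∈ uIcc a b ×ˢ uIcc c d := fun p =>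
    ⟨(projIcc (a ⊓ b) (a ⊔ b) inf_le_sup p.1).2, (projIcc (c ⊓ d) (c ⊔ d) inf_le_sup p.2).2⟩
  have hfix : ∀ p ∈ uIcc a b ×ˢ uIcc c d, π p = p := fun p hp =>
    Prod.ext (congrArg Subtype.val (projIcc_of_mem inf_le_sup hp.1))
      (congrArg Subtype.val (projIcc_of_mem inf_le_sup hp.2))
  let G : C(ℝ × ℝ, {z : ℂ // z ≠ 0}) :=
    ⟨fun p => ⟨F (π p), h0 _ (hmem p)⟩,
      (hF.comp_continuous hπ hmem).subtype_mk _⟩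
  obtain ⟨L, ⟨-, hL⟩, -⟩ := Complex.isCoveringMap_exp.existsUnique_continuousMap_lifts G (0, 0)
    (Complex.log (G (0, 0)).1) (Subtype.ext (Complex.exp_log (G (0, 0)).2))
  refine ⟨fun p => Complex.exp (L p / 2), by fun_prop, fun p hp => ?_⟩
  have h1 : Complex.exp (L p) = F (π p) := congrArg Subtype.val (congrFun hL p)
  rw [← Complex.exp_nat_mul, ← hfix p hp, ← h1, hfix p hp]
  congr 1
  push_cast
  ring

/-- A path that is continuous and nowhere vanishing between the parameters `a` and `b`. -/
structure IsPuncturedPath (γ : ℝ → ℂ) (a b : ℝ) : Prop where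
  continuousOn : ContinuousOn γ (uIcc a b)
  ne_zero : ∀ x ∈ uIcc a b, γ x ≠ 0

theorem IsPuncturedPath.exists_sqrt {γ : ℝ → ℂ} {a b : ℝ} (h : IsPuncturedPath γ a b) :
    ∃ r : ℝ → ℂ, ContinuousOn r (uIcc a b) ∧ ∀ x ∈ uIcc a b, r x ^ 2 = γ x := by
  obtain ⟨r, hr, hr2⟩ := exists_continuousOn_sqrt (F := fun p => γ p.1) (a := a) (b := b)
    (c := 0) (d := 0) (h.continuousOn.comp continuousOn_fst fun p hp => hp.1)
    fun p hp => h.ne_zero _ hp.1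
  have hm : ∀ x ∈ uIcc a b, (x, (0 : ℝ)) ∈ uIcc a b ×ˢ uIcc (0 : ℝ) 0 := fun x hx => ⟨hx, by simp⟩
  exact ⟨fun x => r (x, 0), hr.comp (by fun_prop) hm, fun x hx => hr2 _ (hm x hx)⟩

open Classical in
/-- The quotient of the end values of a continuous square root of `γ` along `[a, b]`. -/
noncomputable def sqrtTransport (γ : ℝ → ℂ) (a b : ℝ) : ℂ :=
  if h : IsPuncturedPath γ a b then h.exists_sqrt.choose b / h.exists_sqrt.choose a else 1

/-- Two continuous square roots on an interval differ by one global sign, which cancels in the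
quotient. -/
theorem IsPuncturedPath.sqrtTransport_eq {γ r : ℝ → ℂ} {a b : ℝ} (h : IsPuncturedPath γ a b)
    (hr : ContinuousOn r (uIcc a b)) (hr2 : ∀ x ∈ uIcc a b, r x ^ 2 = γ x) :
    sqrtTransport γ a b = r b / r a := by
  rw [sqrtTransport, dif_pos h]
  obtain ⟨hs, hs2⟩ := h.exists_sqrt.choose_spec
  set s := h.exists_sqrt.choose
  have hne : ∀ {x}, x ∈ uIcc a b → r x ≠ 0 := fun {x} hx h0 =>
    h.ne_zero x hx (by rw [← hr2 x hx, h0]; simp)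
  rcases isPreconnected_uIcc.eq_or_eq_neg_of_sq_eq hs hr
    (fun x hx => by simp [hs2 x hx, hr2 x hx]) hne with e | e
  · rw [e left_mem_uIcc, e right_mem_uIcc]
  · rw [e left_mem_uIcc, e right_mem_uIcc]
    simp only [Pi.neg_apply, neg_div_neg_eq]

/-- The default value `1` makes this unconditional, so transports can be cancelled without further
hypotheses. -/
theorem sqrtTransport_ne_zero (γ : ℝ → ℂ) (a b : ℝ) : sqrtTransport γ a b ≠ 0 := by
  rw [sqrtTransport]
  split_ifs with h
  · obtain ⟨-, hs2⟩ := h.exists_sqrt.choose_spec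
    have hne : ∀ x, x ∈ uIcc a b → h.exists_sqrt.choose x ≠ 0 := fun x hx h0 =>
      h.ne_zero x hx (by rw [← hs2 x hx, h0]; simp)
    exact div_ne_zero (hne _ right_mem_uIcc) (hne _ left_mem_uIcc)
  · exact one_ne_zero

theorem IsPuncturedPath.sq_sqrtTransport {γ : ℝ → ℂ} {a b : ℝ} (h : IsPuncturedPath γ a b) :
    sqrtTransport γ a b ^ 2 = γ b / γ a := by
  obtain ⟨r, hr, hr2⟩ := h.exists_sqrt
  rw [h.sqrtTransport_eq hr hr2, div_pow, hr2 _ right_mem_uIcc, hr2 _ left_mem_uIcc]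

theorem IsPuncturedPath.symm {γ : ℝ → ℂ} {a b : ℝ} (h : IsPuncturedPath γ a b) :
    IsPuncturedPath γ b a := by
  constructor
  · rw [uIcc_comm]; exact h.1
  · rw [uIcc_comm]; exact h.2

theorem IsPuncturedPath.mono {γ : ℝ → ℂ} {a b a' b' : ℝ} (h : IsPuncturedPath γ a b)
    (ha : a' ∈ uIcc a b) (hb : b' ∈ uIcc a b) : IsPuncturedPath γ a' b' :=
  ⟨h.1.mono (uIcc_subset_uIcc ha hb), fun x hx => h.2 x (uIcc_subset_uIcc ha hb hx)⟩

theorem IsPuncturedPath.sqrtTransport_symm {γ : ℝ → ℂ} {a b : ℝ} (h : IsPuncturedPath γ a b) :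
    sqrtTransport γ b a = (sqrtTransport γ a b)⁻¹ := by
  obtain ⟨r, hr, hr2⟩ := h.exists_sqrt
  rw [h.sqrtTransport_eq hr hr2, h.symm.sqrtTransport_eq (uIcc_comm a b ▸ hr) (uIcc_comm a b ▸ hr2),
    inv_div]

theorem IsPuncturedPath.sqrtTransport_mul {γ : ℝ → ℂ} {a b c : ℝ} (h : IsPuncturedPath γ a c)
    (hb : b ∈ uIcc a c) :
    sqrtTransport γ a b * sqrtTransport γ b c = sqrtTransport γ a c := by
  obtain ⟨r, hr, hr2⟩ := h.exists_sqrt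
  have h1 := uIcc_subset_uIcc (left_mem_uIcc (a := a) (b := c)) hb
  have h2 := uIcc_subset_uIcc hb (right_mem_uIcc (a := a) (b := c))
  have hne : r b ≠ 0 := fun h0 => h.ne_zero b hb (by rw [← hr2 b hb, h0]; simp)
  rw [h.sqrtTransport_eq hr hr2,
    (h.mono left_mem_uIcc hb).sqrtTransport_eq (hr.mono h1) fun x hx => hr2 x (h1 hx),
    (h.mono hb right_mem_uIcc).sqrtTransport_eq (hr.mono h2) fun x hx => hr2 x (h2 hx)]
  field_simp

theorem IsPuncturedPath.neg {γ : ℝ → ℂ} {a b : ℝ} (h : IsPuncturedPath γ a b) :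
    IsPuncturedPath (fun x => -γ x) a b :=
  ⟨h.1.neg, fun x hx => neg_ne_zero.2 (h.2 x hx)⟩

/-- Multiplying a root by `i` gives a root of the negative, with the same quotient of end values.
This is why the order of the two edges in a difference does not affect a side. -/
theorem IsPuncturedPath.sqrtTransport_neg {γ : ℝ → ℂ} {a b : ℝ} (h : IsPuncturedPath γ a b) :
    sqrtTransport (fun x => -γ x) a b = sqrtTransport γ a b := by
  obtain ⟨r, hr, hr2⟩ := h.exists_sqrt
  rw [h.sqrtTransport_eq hr hr2, h.neg.sqrtTransport_eq (r := fun x => Complex.I * r x)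
    (by fun_prop) (fun x hx => by rw [mul_pow, hr2 x hx]; simp),
    mul_div_mul_left _ _ Complex.I_ne_zero]

theorem IsPuncturedPath.congr {γ δ : ℝ → ℂ} {a b : ℝ} (h : IsPuncturedPath γ a b)
    (e : EqOn δ γ (uIcc a b)) : IsPuncturedPath δ a b :=
  ⟨h.1.congr e, fun x hx => by rw [e hx]; exact h.2 x hx⟩

theorem IsPuncturedPath.sqrtTransport_congr {γ δ : ℝ → ℂ} {a b : ℝ} (h : IsPuncturedPath γ a b)
    (e : EqOn δ γ (uIcc a b)) : sqrtTransport δ a b = sqrtTransport γ a b := by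
  obtain ⟨r, hr, hr2⟩ := h.exists_sqrt
  rw [h.sqrtTransport_eq hr hr2, (h.congr e).sqrtTransport_eq hr fun x hx => by
    rw [hr2 x hx, e hx]]

theorem IsPuncturedPath.comp {γ : ℝ → ℂ} {φ : ℝ → ℝ} {a b c d : ℝ} (h : IsPuncturedPath γ c d)
    (hφ : ContinuousOn φ (uIcc a b)) (hm : MapsTo φ (uIcc a b) (uIcc c d)) :
    IsPuncturedPath (fun x => γ (φ x)) a b :=
  ⟨h.1.comp hφ hm, fun _ hx => h.2 _ (hm hx)⟩

/-- Only the ends of `φ` matter: a root pulled back along `φ` is again a root, so no monotonicity is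
needed. -/
theorem IsPuncturedPath.sqrtTransport_comp {γ : ℝ → ℂ} {φ : ℝ → ℝ} {a b c d : ℝ}
    (h : IsPuncturedPath γ c d) (hφ : ContinuousOn φ (uIcc a b))
    (hm : MapsTo φ (uIcc a b) (uIcc c d)) :
    sqrtTransport (fun x => γ (φ x)) a b = sqrtTransport γ (φ a) (φ b) := by
  obtain ⟨r, hr, hr2⟩ := h.exists_sqrt
  have hs := uIcc_subset_uIcc (hm left_mem_uIcc) (hm right_mem_uIcc)
  rw [(h.comp hφ hm).sqrtTransport_eq (r := fun x => r (φ x)) (hr.comp hφ hm)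
      fun x hx => hr2 _ (hm hx),
    (h.mono (hm left_mem_uIcc) (hm right_mem_uIcc)).sqrtTransport_eq (hr.mono hs)
      fun x hx => hr2 x (hs hx)]

/-! ### The holonomy of square roots around a rectangle -/

/-- The sign by which a square root of `F` changes around the boundary of the rectangle
`[a, b] × [c, d]`. -/
noncomputable def holonomy (F : ℝ → ℝ → ℂ) (a b c d : ℝ) : ℂ :=
  sqrtTransport (fun s => F s c) a b * sqrtTransport (F b) c d /
    (sqrtTransport (fun s => F s d) a b * sqrtTransport (F a) c d)

/-- `F` is continuous and nowhere vanishing on the four sides of the rectangle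
`[a, b] × [c, d]`. -/
structure IsPuncturedRectangle (F : ℝ → ℝ → ℂ) (a b c d : ℝ) : Prop where
  bottom : IsPuncturedPath (fun s => F s c) a b
  right : IsPuncturedPath (F b) c d
  top : IsPuncturedPath (fun s => F s d) a b
  left : IsPuncturedPath (F a) c d

/-- The side shared by the two subrectangles contributes once with each exponent and cancels. -/
theorem IsPuncturedRectangle.holonomy_mul {F : ℝ → ℝ → ℂ} {a b b' c d : ℝ}
    (h : IsPuncturedRectangle F a b' c d) (hb : b ∈ uIcc a b') :
    holonomy F a b c d * holonomy F b b' c d = holonomy F a b' c d := by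
  have h1 := h.bottom.sqrtTransport_mul hb
  have h2 := h.top.sqrtTransport_mul hb
  simp only [holonomy, ← h1, ← h2]
  have := sqrtTransport_ne_zero
  field_simp [this]

theorem holonomy_swap (F : ℝ → ℝ → ℂ) (a b c d : ℝ) :
    holonomy (fun t s => F s t) c d a b = (holonomy F a b c d)⁻¹ := by
  simp only [holonomy]
  rw [inv_div, mul_comm (sqrtTransport (fun s => F s c) a b)]
  congr 1
  exact mul_comm _ _

theorem IsPuncturedRectangle.swap {F : ℝ → ℝ → ℂ} {a b c d : ℝ}
    (h : IsPuncturedRectangle F a b c d) : IsPuncturedRectangle (fun t s => F s t) c d a b :=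
  ⟨h.left, h.top, h.right, h.bottom⟩

theorem IsPuncturedRectangle.holonomy_mul' {F : ℝ → ℝ → ℂ} {a b c d d' : ℝ}
    (h : IsPuncturedRectangle F a b c d') (hd : d ∈ uIcc c d') :
    holonomy F a b c d * holonomy F a b d d' = holonomy F a b c d' := by
  have := h.swap.holonomy_mul hd
  rw [holonomy_swap F a b c d, holonomy_swap F a b d d', holonomy_swap F a b c d',
    ← mul_inv] at this
  exact inv_injective this

theorem IsPuncturedRectangle.of_ne_zero {F : ℝ → ℝ → ℂ} {a b c d a' b' c' d' : ℝ}
    (hF : ContinuousOn (fun p : ℝ × ℝ => F p.1 p.2) (uIcc a b ×ˢ uIcc c d))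
    (ha : a' ∈ uIcc a b) (hb : b' ∈ uIcc a b) (hc : c' ∈ uIcc c d) (hd : d' ∈ uIcc c d)
    (h1 : ∀ s ∈ uIcc a' b', F s c' ≠ 0) (h2 : ∀ t ∈ uIcc c' d', F b' t ≠ 0)
    (h3 : ∀ s ∈ uIcc a' b', F s d' ≠ 0) (h4 : ∀ t ∈ uIcc c' d', F a' t ≠ 0) :
    IsPuncturedRectangle F a' b' c' d' := by
  have hs := uIcc_subset_uIcc ha hb
  have ht := uIcc_subset_uIcc hc hd
  refine ⟨⟨?_, h1⟩, ⟨?_, h2⟩, ⟨?_, h3⟩, ⟨?_, h4⟩⟩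
  · exact hF.comp (f := fun s => (s, c')) (by fun_prop) fun s h => ⟨hs h, hc⟩
  · exact hF.comp (f := fun s => (b', s)) (by fun_prop) fun s h => ⟨hb, ht h⟩
  · exact hF.comp (f := fun s => (s, d')) (by fun_prop) fun s h => ⟨hs h, hd⟩
  · exact hF.comp (f := fun s => (a', s)) (by fun_prop) fun s h => ⟨ha, ht h⟩

/-- A square root on the whole rectangle serves all four sides, and its corner values telescope. -/
theorem holonomy_eq_one {F : ℝ → ℝ → ℂ} {a b c d : ℝ}
    (hF : ContinuousOn (fun p : ℝ × ℝ => F p.1 p.2) (uIcc a b ×ˢ uIcc c d))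
    (h0 : ∀ s ∈ uIcc a b, ∀ t ∈ uIcc c d, F s t ≠ 0) : holonomy F a b c d = 1 := by
  obtain ⟨r, hr, hr2⟩ := exists_continuousOn_sqrt hF fun p hp => h0 _ hp.1 _ hp.2
  have hp : IsPuncturedRectangle F a b c d :=
    .of_ne_zero hF left_mem_uIcc right_mem_uIcc left_mem_uIcc right_mem_uIcc
      (fun s hs => h0 s hs _ left_mem_uIcc) (fun t ht => h0 _ right_mem_uIcc t ht)
      (fun s hs => h0 s hs _ right_mem_uIcc) (fun t ht => h0 _ left_mem_uIcc t ht)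
  have hne : ∀ s ∈ uIcc a b, ∀ t ∈ uIcc c d, r (s, t) ≠ 0 := fun s hs t ht hz =>
    h0 s hs t ht (by rw [← hr2 (s, t) ⟨hs, ht⟩, hz]; simp)
  have hs : ∀ t ∈ uIcc c d, ContinuousOn (fun s => r (s, t)) (uIcc a b) := fun t ht =>
    hr.comp (by fun_prop) fun s h => ⟨h, ht⟩
  have ht : ∀ s ∈ uIcc a b, ContinuousOn (fun t => r (s, t)) (uIcc c d) := fun s hs =>
    hr.comp (by fun_prop) fun t h => ⟨hs, h⟩
  rw [holonomy, hp.bottom.sqrtTransport_eq (hs _ left_mem_uIcc)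
      (fun s h => hr2 (s, c) ⟨h, left_mem_uIcc⟩),
    hp.top.sqrtTransport_eq (hs _ right_mem_uIcc) (fun s h => hr2 (s, d) ⟨h, right_mem_uIcc⟩),
    hp.left.sqrtTransport_eq (ht _ left_mem_uIcc) (fun t h => hr2 (a, t) ⟨left_mem_uIcc, h⟩),
    hp.right.sqrtTransport_eq (ht _ right_mem_uIcc) (fun t h => hr2 (b, t) ⟨right_mem_uIcc, h⟩)]
  have n1 := hne a left_mem_uIcc c left_mem_uIcc
  have n2 := hne a left_mem_uIcc d right_mem_uIcc
  have n3 := hne b right_mem_uIcc c left_mem_uIcc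
  have n4 := hne b right_mem_uIcc d right_mem_uIcc
  field_simp

/-- The holonomy around a rectangle is invariant under homotopies that do not vanish on its
boundary. -/
theorem holonomy_homotopy {G : ℝ → ℝ → ℝ → ℂ} {a b c d : ℝ}
    (hG : ContinuousOn
      (fun p : ℝ × ℝ × ℝ => G p.1 p.2.1 p.2.2) (uIcc 0 1 ×ˢ uIcc a b ×ˢ uIcc c d))
    (h1 : ∀ τ ∈ uIcc (0 : ℝ) 1, ∀ s ∈ uIcc a b, G τ s c ≠ 0 ∧ G τ s d ≠ 0)
    (h2 : ∀ τ ∈ uIcc (0 : ℝ) 1, ∀ t ∈ uIcc c d, G τ a t ≠ 0 ∧ G τ b t ≠ 0) :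
    holonomy (G 0) a b c d = holonomy (G 1) a b c d := by
  -- Each side swept out by the homotopy is a zero-free rectangle with trivial holonomy. The
  -- transports of the four corners then cancel around the boundary.
  have k1 := holonomy_eq_one (F := fun τ s => G τ s c) (a := 0) (b := 1) (c := a) (d := b)
    (hG.comp (f := fun p : ℝ × ℝ => (p.1, p.2, c)) (by fun_prop)
      fun p hp => ⟨hp.1, hp.2, left_mem_uIcc⟩) fun τ hτ s hs => (h1 τ hτ s hs).1
  have k2 := holonomy_eq_one (F := fun τ s => G τ s d) (a := 0) (b := 1) (c := a) (d := b)
    (hG.comp (f := fun p : ℝ × ℝ => (p.1, p.2, d)) (by fun_prop)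
      fun p hp => ⟨hp.1, hp.2, right_mem_uIcc⟩) fun τ hτ s hs => (h1 τ hτ s hs).2
  have k3 := holonomy_eq_one (F := fun τ t => G τ a t) (a := 0) (b := 1) (c := c) (d := d)
    (hG.comp (f := fun p : ℝ × ℝ => (p.1, a, p.2)) (by fun_prop)
      fun p hp => ⟨hp.1, left_mem_uIcc, hp.2⟩) fun τ hτ t ht => (h2 τ hτ t ht).1
  have k4 := holonomy_eq_one (F := fun τ t => G τ b t) (a := 0) (b := 1) (c := c) (d := d)
    (hG.comp (f := fun p : ℝ × ℝ => (p.1, b, p.2)) (by fun_prop)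
      fun p hp => ⟨hp.1, right_mem_uIcc, hp.2⟩) fun τ hτ t ht => (h2 τ hτ t ht).2
  have hne := sqrtTransport_ne_zero
  simp only [holonomy] at k1 k2 k3 k4 ⊢
  rw [div_eq_one_iff_eq (mul_ne_zero (hne _ _ _) (hne _ _ _))] at k1 k2 k3 k4
  rw [div_eq_div_iff (mul_ne_zero (hne _ _ _) (hne _ _ _)) (mul_ne_zero (hne _ _ _) (hne _ _ _))]
  have n1 := hne (fun τ => G τ b c) 0 1
  have n2 := hne (fun τ => G τ a d) 0 1
  have n3 := hne (fun τ => G τ b d) 0 1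
  refine mul_left_cancel₀ (mul_ne_zero (mul_ne_zero n1 n2) n3) ?_
  set N2 := sqrtTransport (fun τ => G τ b c) 0 1
  set N3 := sqrtTransport (fun τ => G τ a d) 0 1
  set N4 := sqrtTransport (fun τ => G τ b d) 0 1
  set N1 := sqrtTransport (fun τ => G τ a c) 0 1
  set B1 := sqrtTransport (fun s => G 1 s c) a b
  set T1 := sqrtTransport (fun s => G 1 s d) a b
  set R1 := sqrtTransport (fun t => G 1 b t) c d
  set L1 := sqrtTransport (fun t => G 1 a t) c d
  set R0 := sqrtTransport (fun t => G 0 b t) c d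
  set L0 := sqrtTransport (fun t => G 0 a t) c d
  linear_combination -k1 * (R0 * N4 * N3 * T1 * L1) - k4 * (N1 * B1 * N3 * T1 * L1)
    + k2 * (B1 * R1 * N2 * N3 * L0) + k3 * (B1 * R1 * N2 * N3 * T1)

end PlaneGraph

namespace PlaneGraph

open Set

/-! ### Transversal crossings -/

theorem mem_uIcc_neg_iff {x p : ℝ} : x ∈ uIcc p (-p) ↔ |x| ≤ |p| := by
  rw [mem_uIcc, abs_le]
  rcases abs_cases p with ⟨h, _⟩ | ⟨h, _⟩ <;> rw [h] <;> constructor <;> intro H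
  · rcases H with H | H <;> constructor <;> linarith
  · right; constructor <;> linarith
  · rcases H with H | H <;> constructor <;> linarith
  · left; constructor <;> linarith

theorem neg_mul_mem_uIcc_neg {x p τ : ℝ} (hx : x ∈ uIcc p (-p)) (hτ : τ ∈ uIcc (0 : ℝ) 1) :
    -(τ * x) ∈ uIcc p (-p) := by
  rw [uIcc_of_le zero_le_one] at hτ
  rw [mem_uIcc_neg_iff] at hx ⊢
  rw [abs_neg, abs_mul, abs_of_nonneg hτ.1]
  nlinarith [abs_nonneg x, hτ.1, hτ.2]

theorem IsPuncturedPath.sqrtTransport_reflect {γ δ : ℝ → ℂ} {p : ℝ}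
    (h : IsPuncturedPath γ p (-p)) (e : ∀ x, δ x = -γ (-x)) :
    sqrtTransport δ p (-p) = (sqrtTransport γ p (-p))⁻¹ := by
  rw [funext e, h.neg.sqrtTransport_comp (φ := fun x => -x) continuous_neg.continuousOn
      fun x hx => by rw [mem_uIcc_neg_iff] at hx ⊢; rwa [abs_neg],
    neg_neg, h.neg.sqrtTransport_symm, h.sqrtTransport_neg]

/-- The holonomy of an odd function around a rectangle that is symmetric about the origin. -/
theorem holonomy_of_odd {g : ℝ → ℝ → ℂ} {p q : ℝ} (h : IsPuncturedRectangle g p (-p) q (-q))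
    (hodd : ∀ x y, g (-x) (-y) = -g x y) : holonomy g p (-p) q (-q) = -1 := by
  have hodd' : ∀ x y, g x y = -g (-x) (-y) := fun x y => by rw [hodd, neg_neg]
  -- Reflection in the origin exchanges opposite sides, so the holonomy is the square of the
  -- transport along half the boundary. This equals `g (-p) (-q) / g p q = -1`.
  have e1 : sqrtTransport (fun s => g s (-q)) p (-p) =
      (sqrtTransport (fun s => g s q) p (-p))⁻¹ :=
    h.bottom.sqrtTransport_reflect fun x => by rw [hodd', neg_neg]
  have e2 : sqrtTransport (g p) q (-q) = (sqrtTransport (g (-p)) q (-q))⁻¹ :=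
    h.right.sqrtTransport_reflect fun x => by rw [hodd']
  have s1 := h.bottom.sq_sqrtTransport
  have s2 := h.right.sq_sqrtTransport
  have n1 := h.bottom.ne_zero _ left_mem_uIcc
  have n2 := h.bottom.ne_zero _ right_mem_uIcc
  rw [holonomy, e1, e2, ← mul_inv, div_inv_eq_mul, ← sq, mul_pow, s1, s2, hodd]
  field_simp

/-- The difference of the two branches of a transversal crossing has holonomy `-1` around
the crossing, in coordinates in which the branches are the axes. -/
theorem holonomy_axes {k : ℝ → ℝ → ℂ} {p q : ℝ} (hp : p ≠ 0) (hq : q ≠ 0)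
    (hk : ContinuousOn (fun x : ℝ × ℝ => k x.1 x.2) (uIcc p (-p) ×ˢ uIcc q (-q)))
    (hinj : InjOn (fun x : ℝ × ℝ => k x.1 x.2) (uIcc p (-p) ×ˢ uIcc q (-q))) :
    holonomy (fun x y => k x 0 - k 0 y) p (-p) q (-q) = -1 := by
  -- At `τ = 0` this is the given difference, at `τ = 1` it is odd. By injectivity a zero forces `(1
  -- + τ) x = 0` and `(1 + τ) y = 0`, so the origin is the only zero throughout.
  let G : ℝ → ℝ → ℝ → ℂ := fun τ x y => k x (-(τ * y)) - k (-(τ * x)) y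
  have hG : ContinuousOn (fun z : ℝ × ℝ × ℝ => G z.1 z.2.1 z.2.2)
      (uIcc 0 1 ×ˢ uIcc p (-p) ×ˢ uIcc q (-q)) := by
    refine ContinuousOn.sub (hk.comp (f := fun z : ℝ × ℝ × ℝ => (z.2.1, -(z.1 * z.2.2)))
      (by fun_prop) ?_) (hk.comp (f := fun z : ℝ × ℝ × ℝ => (-(z.1 * z.2.1), z.2.2))
      (by fun_prop) ?_)
    · exact fun z hz => ⟨hz.2.1, neg_mul_mem_uIcc_neg hz.2.2 hz.1⟩
    · exact fun z hz => ⟨neg_mul_mem_uIcc_neg hz.2.1 hz.1, hz.2.2⟩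
  have hne : ∀ τ ∈ uIcc (0 : ℝ) 1, ∀ x ∈ uIcc p (-p), ∀ y ∈ uIcc q (-q), (x ≠ 0 ∨ y ≠ 0) →
      G τ x y ≠ 0 := by
    intro τ hτ x hx y hy hxy h0
    have := hinj (x₁ := (x, -(τ * y))) (x₂ := (-(τ * x), y)) ⟨hx, neg_mul_mem_uIcc_neg hy hτ⟩
      ⟨neg_mul_mem_uIcc_neg hx hτ, hy⟩ (sub_eq_zero (a := k _ _).1 h0)
    rw [Prod.mk.injEq] at this
    rw [uIcc_of_le zero_le_one] at hτ
    have h1 : (1 + τ) * x = 0 := by linarith [this.1]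
    have h2 : (1 + τ) * y = 0 := by linarith [this.2]
    have h3 : (1 + τ) ≠ 0 := by linarith [hτ.1]
    rcases hxy with h | h
    · exact h ((mul_eq_zero.1 h1).resolve_left h3)
    · exact h ((mul_eq_zero.1 h2).resolve_left h3)
  have h1 := holonomy_homotopy hG
    (fun τ hτ s hs => ⟨hne τ hτ s hs _ left_mem_uIcc (.inr hq),
      hne τ hτ s hs _ right_mem_uIcc (.inr (neg_ne_zero.2 hq))⟩)
    (fun τ hτ t ht => ⟨hne τ hτ _ left_mem_uIcc t ht (.inl hp),
      hne τ hτ _ right_mem_uIcc t ht (.inl (neg_ne_zero.2 hp))⟩)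
  have h2 : G 0 = fun x y => k x 0 - k 0 y := by
    funext x y
    simp [G]
  rw [h2] at h1
  rw [h1]
  have one_mem : (1 : ℝ) ∈ uIcc (0 : ℝ) 1 := right_mem_uIcc
  refine holonomy_of_odd (.of_ne_zero (hG.comp (f := fun z : ℝ × ℝ => (1, z.1, z.2))
      (by fun_prop) fun z hz => ⟨one_mem, hz.1, hz.2⟩) left_mem_uIcc right_mem_uIcc left_mem_uIcc
      right_mem_uIcc ?_ ?_ ?_ ?_) fun x y => by simp [G]
  · exact fun s hs => hne 1 one_mem s hs _ left_mem_uIcc (.inr hq)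
  · exact fun t ht => hne 1 one_mem _ right_mem_uIcc t ht (.inl (neg_ne_zero.2 hp))
  · exact fun s hs => hne 1 one_mem s hs _ right_mem_uIcc (.inr (neg_ne_zero.2 hq))
  · exact fun t ht => hne 1 one_mem _ left_mem_uIcc t ht (.inl hp)

theorem exists_symmetric_values_of_strictMonoOn {α : ℝ → ℝ} {s₀ δ : ℝ} (hδ : 0 < δ)
    (hα : ContinuousOn α (Icc (s₀ - δ) (s₀ + δ))) (hmono : StrictMonoOn α (Icc (s₀ - δ) (s₀ + δ)))
    (h0 : α s₀ = 0) :
    ∃ r > 0, ∀ c, 0 < c → c < r → ∃ s₁ s₂, s₀ - δ < s₁ ∧ s₁ < s₀ ∧ s₀ < s₂ ∧ s₂ < s₀ + δ ∧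
      α s₁ = -c ∧ α s₂ = c ∧ ∀ s ∈ Icc s₁ s₂, |α s| ≤ c := by
  have ml : s₀ - δ ∈ Icc (s₀ - δ) (s₀ + δ) := ⟨le_rfl, by linarith⟩
  have mr : s₀ + δ ∈ Icc (s₀ - δ) (s₀ + δ) := ⟨by linarith, le_rfl⟩
  have m0 : s₀ ∈ Icc (s₀ - δ) (s₀ + δ) := ⟨by linarith, by linarith⟩
  have hl : α (s₀ - δ) < 0 := h0 ▸ hmono ml m0 (by linarith)
  have hr : 0 < α (s₀ + δ) := h0 ▸ hmono m0 mr (by linarith)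
  refine ⟨min (-α (s₀ - δ)) (α (s₀ + δ)), lt_min (by linarith) hr, fun c hc hcr => ?_⟩
  rw [lt_min_iff] at hcr
  obtain ⟨s₁, ⟨m1, m1'⟩, e1⟩ := intermediate_value_Ioo (by linarith)
    (hα.mono (Icc_subset_Icc le_rfl (by linarith))) (show -c ∈ Ioo (α (s₀ - δ)) (α s₀) from
      ⟨by linarith, by linarith⟩)
  obtain ⟨s₂, ⟨m2, m2'⟩, e2⟩ := intermediate_value_Ioo (by linarith)
    (hα.mono (Icc_subset_Icc (by linarith) le_rfl)) (show c ∈ Ioo (α s₀) (α (s₀ + δ)) from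
      ⟨by linarith, by linarith⟩)
  refine ⟨s₁, s₂, m1, m1', m2, m2', e1, e2, fun s hs => abs_le.2 ⟨?_, ?_⟩⟩
  · rw [← e1]
    exact hmono.monotoneOn ⟨by linarith, by linarith⟩ ⟨by linarith [hs.1], by linarith [hs.2]⟩ hs.1
  · rw [← e2]
    exact hmono.monotoneOn ⟨by linarith [hs.1], by linarith [hs.2]⟩ ⟨by linarith, by linarith⟩ hs.2

/-- A continuous injective function on an interval is strictly monotone or antitone, so the
intermediate value theorem reaches both `c` and `-c`. The symmetric rectangle required by
`holonomy_axes` is obtained in this way. -/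
theorem exists_symmetric_values {α : ℝ → ℝ} {s₀ δ : ℝ} (hδ : 0 < δ)
    (hα : ContinuousOn α (Icc (s₀ - δ) (s₀ + δ))) (hinj : InjOn α (Icc (s₀ - δ) (s₀ + δ)))
    (h0 : α s₀ = 0) :
    ∃ r > 0, ∀ c, 0 < c → c < r → ∃ s₁ s₂, s₀ - δ < s₁ ∧ s₁ < s₀ ∧ s₀ < s₂ ∧ s₂ < s₀ + δ ∧
      α s₂ = -α s₁ ∧ |α s₁| = c ∧ ∀ s ∈ Icc s₁ s₂, |α s| ≤ c := by
  rcases hα.strictMonoOn_of_injOn_Icc' (by linarith) hinj with h | h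
  · obtain ⟨r, hr, H⟩ := exists_symmetric_values_of_strictMonoOn hδ hα h h0
    refine ⟨r, hr, fun c hc hcr => ?_⟩
    obtain ⟨s₁, s₂, h1, h2, h3, h4, e1, e2, h5⟩ := H c hc hcr
    exact ⟨s₁, s₂, h1, h2, h3, h4, by rw [e1, e2, neg_neg], by rw [e1, abs_neg, abs_of_pos hc], h5⟩
  · obtain ⟨r, hr, H⟩ := exists_symmetric_values_of_strictMonoOn hδ hα.neg h.neg (by simp [h0])
    refine ⟨r, hr, fun c hc hcr => ?_⟩
    obtain ⟨s₁, s₂, h1, h2, h3, h4, e1, e2, h5⟩ := H c hc hcr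
    simp only [Pi.neg_apply, abs_neg] at e1 e2 h5
    exact ⟨s₁, s₂, h1, h2, h3, h4, by linarith, by rw [neg_inj.1 e1, abs_of_pos hc], h5⟩

/-- The branches run along the axes of the chart `k` with parameters `α` and `β`. Transport does not
see the parametrization, so the holonomy is that of a symmetric rectangle in the chart. -/
theorem exists_holonomy_eq_neg_one {A B : ℝ → ℂ} {k : ℝ → ℝ → ℂ} {α β : ℝ → ℝ} {s₀ t₀ ρ δ : ℝ}
    (hρ : 0 < ρ) (hδ : 0 < δ)
    (hk : ContinuousOn (fun x : ℝ × ℝ => k x.1 x.2) (Icc (-ρ) ρ ×ˢ Icc (-ρ) ρ))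
    (hinj : InjOn (fun x : ℝ × ℝ => k x.1 x.2) (Icc (-ρ) ρ ×ˢ Icc (-ρ) ρ))
    (hα : ContinuousOn α (Icc (s₀ - δ) (s₀ + δ))) (hα' : InjOn α (Icc (s₀ - δ) (s₀ + δ)))
    (hα0 : α s₀ = 0) (hA : ∀ s ∈ Icc (s₀ - δ) (s₀ + δ), A s = k (α s) 0)
    (hβ : ContinuousOn β (Icc (t₀ - δ) (t₀ + δ))) (hβ' : InjOn β (Icc (t₀ - δ) (t₀ + δ)))
    (hβ0 : β t₀ = 0) (hB : ∀ t ∈ Icc (t₀ - δ) (t₀ + δ), B t = k 0 (β t)) :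
    ∃ s₁ s₂ t₁ t₂, s₀ - δ < s₁ ∧ s₁ < s₀ ∧ s₀ < s₂ ∧ s₂ < s₀ + δ ∧
      t₀ - δ < t₁ ∧ t₁ < t₀ ∧ t₀ < t₂ ∧ t₂ < t₀ + δ ∧
      holonomy (fun s t => A s - B t) s₁ s₂ t₁ t₂ = -1 := by
  obtain ⟨r, hr, H⟩ := exists_symmetric_values hδ hα hα' hα0
  obtain ⟨r', hr', H'⟩ := exists_symmetric_values hδ hβ hβ' hβ0
  set c := min (min r r') ρ / 2 with hc
  have hm : 0 < min (min r r') ρ := lt_min (lt_min hr hr') hρ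
  have hc0 : 0 < c := by positivity
  have hlt : c < min (min r r') ρ := by linarith
  have hcr : c < r := lt_of_lt_of_le hlt ((min_le_left _ _).trans (min_le_left _ _))
  have hcr' : c < r' := lt_of_lt_of_le hlt ((min_le_left _ _).trans (min_le_right _ _))
  have hcρ : c < ρ := lt_of_lt_of_le hlt (min_le_right _ _)
  obtain ⟨s₁, s₂, h1, h2, h3, h4, es, e1, h5⟩ := H c hc0 hcr
  obtain ⟨t₁, t₂, h1', h2', h3', h4', et, e1', h5'⟩ := H' c hc0 hcr'
  refine ⟨s₁, s₂, t₁, t₂, h1, h2, h3, h4, h1', h2', h3', h4', ?_⟩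
  set p := α s₁ with hp
  set q := β t₁ with hq
  have hp0 : p ≠ 0 := fun h => by rw [h, abs_zero] at e1; linarith
  have hq0 : q ≠ 0 := fun h => by rw [h, abs_zero] at e1'; linarith
  have hsub : ∀ x : ℝ, |x| = c → uIcc x (-x) ⊆ Icc (-ρ) ρ := fun x hx y hy => by
    rw [mem_uIcc_neg_iff, hx] at hy
    exact abs_le.1 (hy.trans hcρ.le)
  have zp : (0 : ℝ) ∈ uIcc p (-p) := by rw [mem_uIcc_neg_iff]; simp
  have zq : (0 : ℝ) ∈ uIcc q (-q) := by rw [mem_uIcc_neg_iff]; simp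
  have hk' := hk.mono (prod_mono (hsub p e1) (hsub q e1'))
  have hinj' := hinj.mono (prod_mono (hsub p e1) (hsub q e1'))
  have hne : ∀ x ∈ uIcc p (-p), ∀ y ∈ uIcc q (-q), (x ≠ 0 ∨ y ≠ 0) → k x 0 - k 0 y ≠ 0 := by
    intro x hx y hy hxy h0
    have := hinj' (x₁ := (x, 0)) (x₂ := (0, y)) ⟨hx, zq⟩ ⟨zp, hy⟩ (sub_eq_zero (a := k _ _).1 h0)
    rw [Prod.mk.injEq] at this
    rcases hxy with h | h
    exacts [h this.1, h this.2.symm]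
  have hcont : ContinuousOn (fun z : ℝ × ℝ => k z.1 0 - k 0 z.2) (uIcc p (-p) ×ˢ uIcc q (-q)) :=
    (hk'.comp (f := fun z : ℝ × ℝ => (z.1, 0)) (by fun_prop) fun z hz => ⟨hz.1, zq⟩).sub
      (hk'.comp (f := fun z : ℝ × ℝ => (0, z.2)) (by fun_prop) fun z hz => ⟨zp, hz.2⟩)
  have hrect : IsPuncturedRectangle (fun x y => k x 0 - k 0 y) p (-p) q (-q) := by
    refine .of_ne_zero hcont left_mem_uIcc right_mem_uIcc left_mem_uIcc right_mem_uIcc ?_ ?_ ?_ ?_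
    · exact fun s hs => hne s hs _ left_mem_uIcc (.inr hq0)
    · exact fun t ht => hne _ right_mem_uIcc t ht (.inl (neg_ne_zero.2 hp0))
    · exact fun s hs => hne s hs _ right_mem_uIcc (.inr (neg_ne_zero.2 hq0))
    · exact fun t ht => hne _ left_mem_uIcc t ht (.inl hp0)
  have hss : uIcc s₁ s₂ ⊆ Icc (s₀ - δ) (s₀ + δ) := by
    rw [uIcc_of_le (by linarith)]; exact Icc_subset_Icc (by linarith) (by linarith)
  have htt : uIcc t₁ t₂ ⊆ Icc (t₀ - δ) (t₀ + δ) := by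
    rw [uIcc_of_le (by linarith)]; exact Icc_subset_Icc (by linarith) (by linarith)
  have ms : MapsTo α (uIcc s₁ s₂) (uIcc p (-p)) := fun s hs => by
    rw [uIcc_of_le (by linarith)] at hs
    rw [mem_uIcc_neg_iff, e1]; exact h5 s hs
  have mt : MapsTo β (uIcc t₁ t₂) (uIcc q (-q)) := fun t ht => by
    rw [uIcc_of_le (by linarith)] at ht
    rw [mem_uIcc_neg_iff, e1']; exact h5' t ht
  have key : ∀ t ∈ uIcc t₁ t₂, IsPuncturedPath (fun x => k x 0 - k 0 (β t)) p (-p) →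
      sqrtTransport (fun s => A s - B t) s₁ s₂ =
        sqrtTransport (fun x => k x 0 - k 0 (β t)) p (-p) := by
    intro t ht hpath
    rw [(hpath.comp (hα.mono hss) ms).sqrtTransport_congr
        (δ := fun s => A s - B t) fun s hs => by simp only [hA s (hss hs), hB t (htt ht)],
      hpath.sqrtTransport_comp (hα.mono hss) ms, es]
  have key' : ∀ s ∈ uIcc s₁ s₂, IsPuncturedPath (fun y => k (α s) 0 - k 0 y) q (-q) →
      sqrtTransport (fun t => A s - B t) t₁ t₂ =
        sqrtTransport (fun y => k (α s) 0 - k 0 y) q (-q) := by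
    intro s hs hpath
    rw [(hpath.comp (hβ.mono htt) mt).sqrtTransport_congr
        (δ := fun t => A s - B t) fun t ht => by simp only [hA s (hss hs), hB t (htt ht)],
      hpath.sqrtTransport_comp (hβ.mono htt) mt, et]
  rw [← holonomy_axes hp0 hq0 hk' hinj']
  simp only [holonomy]
  rw [key t₁ left_mem_uIcc hrect.bottom, key t₂ right_mem_uIcc (et ▸ hrect.top),
    key' s₁ left_mem_uIcc hrect.left, key' s₂ right_mem_uIcc (es ▸ hrect.right), es, et]

/-! ### Counting zeros by the holonomy -/

/-- Arbitrarily small rectangles around the point `(s₀, t₀)` have holonomy `-1`. -/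
def HasOddHolonomyAt (F : ℝ → ℝ → ℂ) (s₀ t₀ : ℝ) : Prop :=
  ∀ ε > 0, ∃ s₁ s₂ t₁ t₂, s₀ - ε < s₁ ∧ s₁ < s₀ ∧ s₀ < s₂ ∧ s₂ < s₀ + ε ∧
    t₀ - ε < t₁ ∧ t₁ < t₀ ∧ t₀ < t₂ ∧ t₂ < t₀ + ε ∧ holonomy F s₁ s₂ t₁ t₂ = -1

/-- A small rectangle around the only zero has holonomy `-1`; the four strips cut off around it are
zero-free and contribute `1`. -/
theorem holonomy_eq_neg_one {F : ℝ → ℝ → ℂ} {a b c d s₀ t₀ : ℝ}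
    (hF : ContinuousOn (fun p : ℝ × ℝ => F p.1 p.2) (uIcc a b ×ˢ uIcc c d))
    (hs : s₀ ∈ Ioo a b) (ht : t₀ ∈ Ioo c d)
    (h0 : ∀ s ∈ Icc a b, ∀ t ∈ Icc c d, F s t = 0 → s = s₀ ∧ t = t₀)
    (hodd : HasOddHolonomyAt F s₀ t₀) : holonomy F a b c d = -1 := by
  obtain ⟨s₁, s₂, t₁, t₂, h1, h2, h3, h4, h5, h6, h7, h8, hh⟩ := hodd
    (min (min (s₀ - a) (b - s₀)) (min (t₀ - c) (d - t₀)))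
    (lt_min (lt_min (by linarith [hs.1]) (by linarith [hs.2]))
      (lt_min (by linarith [ht.1]) (by linarith [ht.2])))
  set ε := min (min (s₀ - a) (b - s₀)) (min (t₀ - c) (d - t₀))
  have l1 : ε ≤ s₀ - a := (min_le_left _ _).trans (min_le_left _ _)
  have l2 : ε ≤ b - s₀ := (min_le_left _ _).trans (min_le_right _ _)
  have l3 : ε ≤ t₀ - c := (min_le_right _ _).trans (min_le_left _ _)
  have l4 : ε ≤ d - t₀ := (min_le_right _ _).trans (min_le_right _ _)
  obtain ⟨hs1, hs2⟩ := hs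
  obtain ⟨ht1, ht2⟩ := ht
  have eab : uIcc a b = Icc a b := uIcc_of_le (by linarith)
  have ecd : uIcc c d = Icc c d := uIcc_of_le (by linarith)
  have rect : ∀ a' b' c' d', a ≤ a' → a' ≤ b' → b' ≤ b → c ≤ c' → c' ≤ d' → d' ≤ d →
      a' ≠ s₀ → b' ≠ s₀ → c' ≠ t₀ → d' ≠ t₀ → IsPuncturedRectangle F a' b' c' d' := by
    intro a' b' c' d' g1 g2 g3 g4 g5 g6 n1 n2 n3 n4
    refine .of_ne_zero hF ?_ ?_ ?_ ?_ ?_ ?_ ?_ ?_ <;>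
      simp only [eab, ecd, uIcc_of_le g2, uIcc_of_le g5, mem_Icc]
    · exact ⟨g1, g2.trans g3⟩
    · exact ⟨g1.trans g2, g3⟩
    · exact ⟨g4, g5.trans g6⟩
    · exact ⟨g4.trans g5, g6⟩
    · exact fun s hs h => n3 (h0 s ⟨g1.trans hs.1, hs.2.trans g3⟩ _ ⟨g4, g5.trans g6⟩ h).2
    · exact fun t ht h => n2 (h0 _ ⟨g1.trans g2, g3⟩ t ⟨g4.trans ht.1, ht.2.trans g6⟩ h).1
    · exact fun s hs h => n4 (h0 s ⟨g1.trans hs.1, hs.2.trans g3⟩ _ ⟨g4.trans g5, g6⟩ h).2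
    · exact fun t ht h => n1 (h0 _ ⟨g1, g2.trans g3⟩ t ⟨g4.trans ht.1, ht.2.trans g6⟩ h).1
  have triv : ∀ a' b' c' d', a ≤ a' → a' ≤ b' → b' ≤ b → c ≤ c' → c' ≤ d' → d' ≤ d →
      (b' < s₀ ∨ s₀ < a' ∨ d' < t₀ ∨ t₀ < c') → holonomy F a' b' c' d' = 1 := by
    intro a' b' c' d' g1 g2 g3 g4 g5 g6 hor
    have m1 : uIcc a' b' ⊆ uIcc a b := by
      rw [eab, uIcc_of_le g2]; exact Icc_subset_Icc g1 g3
    have m2 : uIcc c' d' ⊆ uIcc c d := by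
      rw [ecd, uIcc_of_le g5]; exact Icc_subset_Icc g4 g6
    refine holonomy_eq_one (hF.mono (prod_mono m1 m2)) fun s hs t ht h => ?_
    obtain ⟨rfl, rfl⟩ := h0 s (eab ▸ m1 hs) t (ecd ▸ m2 ht) h
    rw [uIcc_of_le g2] at hs
    rw [uIcc_of_le g5] at ht
    rcases hor with h | h | h | h
    · exact absurd hs.2 (not_le.2 h)
    · exact absurd hs.1 (not_le.2 h)
    · exact absurd ht.2 (not_le.2 h)
    · exact absurd ht.1 (not_le.2 h)
  rw [← (rect a b c d le_rfl (by linarith) le_rfl le_rfl (by linarith) le_rfl (by linarith)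
      (by linarith) (by linarith) (by linarith)).holonomy_mul (b := s₁)
      (by rw [eab]; constructor <;> linarith),
    triv a s₁ c d le_rfl (by linarith) (by linarith) le_rfl (by linarith) le_rfl (.inl h2), one_mul,
    ← (rect s₁ b c d (by linarith) (by linarith) le_rfl le_rfl (by linarith) le_rfl (by linarith)
      (by linarith) (by linarith) (by linarith)).holonomy_mul (b := s₂)
      (by rw [uIcc_of_le (by linarith)]; constructor <;> linarith),
    triv s₂ b c d (by linarith) (by linarith) le_rfl le_rfl (by linarith) le_rfl (.inr (.inl h3)),
    mul_one,
    ← (rect s₁ s₂ c d (by linarith) (by linarith) (by linarith) le_rfl (by linarith) le_rfl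
      (by linarith) (by linarith) (by linarith) (by linarith)).holonomy_mul' (d := t₁)
      (by rw [ecd]; constructor <;> linarith),
    triv s₁ s₂ c t₁ (by linarith) (by linarith) (by linarith) le_rfl (by linarith) (by linarith)
      (.inr (.inr (.inl h6))), one_mul,
    ← (rect s₁ s₂ t₁ d (by linarith) (by linarith) (by linarith) (by linarith) (by linarith) le_rfl
      (by linarith) (by linarith) (by linarith) (by linarith)).holonomy_mul' (d := t₂)
      (by rw [uIcc_of_le (by linarith)]; constructor <;> linarith),
    triv s₁ s₂ t₂ d (by linarith) (by linarith) (by linarith) (by linarith) (by linarith) le_rfl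
      (.inr (.inr (.inr h7))), mul_one, hh]

/-- If the zeros of `F` in a rectangle lie in its interior, have distinct first coordinates and
odd local holonomy, then the holonomy around the rectangle is the parity of their number. -/
theorem holonomy_eq_neg_one_pow_card {F : ℝ → ℝ → ℂ} {c d : ℝ} (hcd : c ≤ d) (n : ℕ) :
    ∀ {a b : ℝ} (Z : Finset (ℝ × ℝ)), Z.card = n → a ≤ b →
    ContinuousOn (fun p : ℝ × ℝ => F p.1 p.2) (uIcc a b ×ˢ uIcc c d) →
    (∀ z ∈ Z, z ∈ Ioo a b ×ˢ Ioo c d) →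
    (∀ s ∈ Icc a b, ∀ t ∈ Icc c d, F s t = 0 → (s, t) ∈ Z) →
    (∀ z ∈ Z, ∀ w ∈ Z, z.1 = w.1 → z = w) →
    (∀ z ∈ Z, HasOddHolonomyAt F z.1 z.2) →
    holonomy F a b c d = (-1) ^ n := by
  induction n with
  | zero =>
    intro a b Z hZ hab hF _ h0 _ _
    rw [Finset.card_eq_zero] at hZ
    subst hZ
    rw [pow_zero]
    refine holonomy_eq_one hF fun s hs t ht h => ?_
    rw [uIcc_of_le hab] at hs
    rw [uIcc_of_le hcd] at ht
    simpa using h0 s hs t ht h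
  | succ n ih =>
    intro a b Z hZ hab hF hin h0 hd hodd
    have hne : Z.Nonempty := Finset.card_pos.1 (by omega)
    obtain ⟨z, hz, hmin⟩ := Z.exists_min_image Prod.fst hne
    obtain ⟨⟨z1, z2⟩, z3, z4⟩ := hin z hz
    have hlt : ∀ w ∈ Z.erase z, z.1 < w.1 := fun w hw =>
      lt_of_le_of_ne (hmin w (Finset.mem_of_mem_erase hw)) fun e =>
        Finset.ne_of_mem_erase hw (hd w (Finset.mem_of_mem_erase hw) z hz e.symm)
    -- The line with first coordinate `m` separates the leftmost zero from all others; distinct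
    -- first coordinates make this possible.
    obtain ⟨m, hm1, hm2, hm3⟩ : ∃ m, z.1 < m ∧ m < b ∧ ∀ w ∈ Z.erase z, m < w.1 := by
      rcases (Z.erase z).eq_empty_or_nonempty with he | he
      · obtain ⟨m, h1, h2⟩ := exists_between z2
        exact ⟨m, h1, h2, by simp [he]⟩
      · obtain ⟨w, hw, hwmin⟩ := (Z.erase z).exists_min_image Prod.fst he
        obtain ⟨m, h1, h2⟩ := exists_between (hlt w hw)
        exact ⟨m, h1, h2.trans (hin w (Finset.mem_of_mem_erase hw)).1.2,
          fun w' hw' => h2.trans_le (hwmin w' hw')⟩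
    have eab : uIcc a b = Icc a b := uIcc_of_le hab
    have ecd : uIcc c d = Icc c d := uIcc_of_le hcd
    have hbd : ∀ s ∈ Icc a b, ∀ t ∈ Icc c d, (s = a ∨ s = b ∨ t = c ∨ t = d) → F s t ≠ 0 := by
      intro s hs t ht hor h
      obtain ⟨⟨g1, g2⟩, g3, g4⟩ := hin _ (h0 s hs t ht h)
      dsimp only at g1 g2 g3 g4
      rcases hor with rfl | rfl | rfl | rfl
      exacts [lt_irrefl _ g1, lt_irrefl _ g2, lt_irrefl _ g3, lt_irrefl _ g4]
    have hrect : IsPuncturedRectangle F a b c d := by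
      refine .of_ne_zero hF left_mem_uIcc right_mem_uIcc left_mem_uIcc right_mem_uIcc
        ?_ ?_ ?_ ?_ <;>
        simp only [eab, ecd]
      · exact fun s hs => hbd s hs c ⟨le_rfl, hcd⟩ (by simp)
      · exact fun t ht => hbd b ⟨hab, le_rfl⟩ t ht (by simp)
      · exact fun s hs => hbd s hs d ⟨hcd, le_rfl⟩ (by simp)
      · exact fun t ht => hbd a ⟨le_rfl, hab⟩ t ht (by simp)
    have ham : a ≤ m := by linarith
    rw [← hrect.holonomy_mul (b := m) (by rw [eab]; constructor <;> linarith), pow_succ']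
    congr 1
    · refine holonomy_eq_neg_one (s₀ := z.1) (t₀ := z.2) (hF.mono (prod_mono ?_ le_rfl)) ⟨z1, hm1⟩
        ⟨z3, z4⟩ ?_ (hodd z hz)
      · rw [eab, uIcc_of_le ham]; exact Icc_subset_Icc le_rfl hm2.le
      · intro s hs t ht h
        have hmem := h0 s ⟨hs.1, hs.2.trans hm2.le⟩ t ht h
        by_contra hcon
        have : (s, t) ∈ Z.erase z := Finset.mem_erase.2
          ⟨fun e => hcon ⟨congrArg Prod.fst e, congrArg Prod.snd e⟩, hmem⟩
        exact absurd hs.2 (not_le.2 (hm3 _ this))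
    · refine ih (Z.erase z) (by rw [Finset.card_erase_of_mem hz]; omega) hm2.le
        (hF.mono (prod_mono ?_ le_rfl)) (fun w hw => ?_) (fun s hs t ht h => ?_) ?_ ?_
      · rw [eab, uIcc_of_le hm2.le]; exact Icc_subset_Icc ham le_rfl
      · have := hin w (Finset.mem_of_mem_erase hw)
        exact ⟨⟨hm3 w hw, this.1.2⟩, this.2⟩
      · have hmem := h0 s ⟨ham.trans hs.1, hs.2⟩ t ht h
        refine Finset.mem_erase.2 ⟨fun e => ?_, hmem⟩
        rw [← e] at hm1
        exact absurd hs.1 (not_le.2 hm1)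
      · exact fun z hz w hw => hd z (Finset.mem_of_mem_erase hz) w (Finset.mem_of_mem_erase hw)
      · exact fun z hz => hodd z (Finset.mem_of_mem_erase hz)

end PlaneGraph

namespace PlaneGraph

open Set

/-! ### Edges of the realization and the parity of crossings of two disjoint edges -/

section EdgePoints

variable {V : Type*} [DecidableEq V] {G : SimpleGraph V}

/-- The point of the segment from the vertex `u` to the vertex `v` with parameter `s`. -/
noncomputable def edgeMap (u v : V) (s : ℝ) : V → ℝ :=
  (1 - s) • Pi.single u 1 + s • Pi.single v 1

theorem edgeMap_zero (u v : V) : edgeMap u v 0 = Pi.single u 1 := by simp [edgeMap]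

theorem edgeMap_one (u v : V) : edgeMap u v 1 = Pi.single v 1 := by simp [edgeMap]

theorem continuous_edgeMap (u v : V) : Continuous (edgeMap u v) := by
  unfold edgeMap
  fun_prop

theorem edgeMap_apply_left {u v : V} (h : u ≠ v) (s : ℝ) : edgeMap u v s u = 1 - s := by
  simp [edgeMap, h]

theorem edgeMap_apply_right {u v : V} (h : u ≠ v) (s : ℝ) : edgeMap u v s v = s := by
  simp [edgeMap, h.symm]

theorem edgeMap_apply_of_ne {u v w : V} (hu : w ≠ u) (hv : w ≠ v) (s : ℝ) :
    edgeMap u v s w = 0 := by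
  simp [edgeMap, hu, hv]

theorem edgeMap_mem_segment (u v : V) {s : ℝ} (hs : s ∈ Icc (0 : ℝ) 1) :
    edgeMap u v s ∈ segment ℝ (Pi.single u (1 : ℝ)) (Pi.single v (1 : ℝ)) :=
  ⟨1 - s, s, by linarith [hs.2], hs.1, by ring, rfl⟩

theorem exists_edgeMap_of_mem_segment {u v : V} {x : V → ℝ}
    (h : x ∈ segment ℝ (Pi.single u (1 : ℝ)) (Pi.single v (1 : ℝ))) :
    ∃ s ∈ Icc (0 : ℝ) 1, x = edgeMap u v s := by
  obtain ⟨a, b, ha, hb, hab, rfl⟩ := h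
  refine ⟨b, ⟨hb, by linarith⟩, ?_⟩
  rw [edgeMap, ← hab, add_sub_cancel_right]

theorem edgeMap_mem_polyhedron {H : G.Subgraph} {u v : V} (h : H.Adj u v) {s : ℝ}
    (hs : s ∈ Icc (0 : ℝ) 1) : edgeMap u v s ∈ polyhedron H :=
  .inr ⟨u, v, h, edgeMap_mem_segment u v hs⟩

theorem edgeMap_injective {u v : V} (h : u ≠ v) : Function.Injective (edgeMap u v) :=
  fun s t e => by rw [← edgeMap_apply_right h s, e, edgeMap_apply_right h]

theorem edgeMap_ne_single {u v : V} (h : u ≠ v) {s : ℝ} (hs : s ∈ Ioo (0 : ℝ) 1) (w : V) :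
    edgeMap u v s ≠ Pi.single w 1 := by
  intro e
  have h1 := congrFun e u
  have h2 := congrFun e v
  rw [edgeMap_apply_left h] at h1
  rw [edgeMap_apply_right h] at h2
  by_cases hu : u = w
  · subst hu
    rw [Pi.single_eq_of_ne h.symm] at h2
    linarith [hs.1]
  · rw [Pi.single_eq_of_ne hu] at h1
    linarith [hs.2]

/-- The ends of an edge are recovered from an interior point as the vertices with nonzero
coordinate. -/
theorem edgeMap_eq_imp {u v u' v' : V} (h : u ≠ v) {s t : ℝ} (hs : s ∈ Ioo (0 : ℝ) 1)
    (e : edgeMap u v s = edgeMap u' v' t) : (u = u' ∧ v = v') ∨ (u = v' ∧ v = u') := by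
  have h1 := congrFun e u
  have h2 := congrFun e v
  rw [edgeMap_apply_left h] at h1
  rw [edgeMap_apply_right h] at h2
  have hu : u = u' ∨ u = v' := by
    by_contra! hc
    rw [edgeMap_apply_of_ne hc.1 hc.2] at h1
    linarith [hs.2]
  have hv : v = u' ∨ v = v' := by
    by_contra! hc
    rw [edgeMap_apply_of_ne hc.1 hc.2] at h2
    linarith [hs.1]
  rcases hu with rfl | rfl <;> rcases hv with rfl | rfl <;> simp_all

theorem edgeMap_mem_polyhedron_iff {H : G.Subgraph} {u v : V} (h : u ≠ v) {s : ℝ}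
    (hs : s ∈ Ioo (0 : ℝ) 1) : edgeMap u v s ∈ polyhedron H ↔ H.Adj u v := by
  refine ⟨?_, fun h => edgeMap_mem_polyhedron h (Ioo_subset_Icc_self hs)⟩
  rintro (⟨w, -, e⟩ | ⟨a, b, hab, hx⟩)
  · exact absurd e (edgeMap_ne_single h hs w)
  · obtain ⟨t, -, e⟩ := exists_edgeMap_of_mem_segment hx
    rcases edgeMap_eq_imp h hs e with ⟨rfl, rfl⟩ | ⟨rfl, rfl⟩
    exacts [hab, hab.symm]

theorem edgeMap_ne_of_disjoint {u v u' v' : V} (h : u ≠ v) (h1 : u ≠ u') (h2 : u ≠ v')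
    (h3 : v ≠ u') (h4 : v ≠ v') (s t : ℝ) : edgeMap u v s ≠ edgeMap u' v' t := by
  intro e
  have e1 := congrFun e u
  have e2 := congrFun e v
  rw [edgeMap_apply_left h, edgeMap_apply_of_ne h1 h2] at e1
  rw [edgeMap_apply_right h, edgeMap_apply_of_ne h3 h4] at e2
  linarith

/-- The parametrization of the edge `uv` of the space `G` by `[0, 1]`, constant elsewhere. -/
noncomputable def edgePoint {u v : V} (h : G.Adj u v) (s : ℝ) : Realization G :=
  ⟨edgeMap u v (projIcc 0 1 zero_le_one s),
    edgeMap_mem_polyhedron (SimpleGraph.Subgraph.top_adj.2 h) (projIcc 0 1 zero_le_one s).2⟩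

theorem edgePoint_val {u v : V} (h : G.Adj u v) {s : ℝ} (hs : s ∈ Icc (0 : ℝ) 1) :
    (edgePoint h s).1 = edgeMap u v s :=
  congrArg (fun x : Icc (0 : ℝ) 1 => edgeMap u v x) (projIcc_of_mem zero_le_one hs)

theorem continuous_edgePoint {u v : V} (h : G.Adj u v) : Continuous (edgePoint h) :=
  ((continuous_edgeMap u v).comp (continuous_subtype_val.comp continuous_projIcc)).subtype_mk _

theorem edgePoint_injOn {u v : V} (h : G.Adj u v) : InjOn (edgePoint h) (Icc 0 1) :=
  fun s hs t ht e => edgeMap_injective h.ne <| by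
    rw [← edgePoint_val h hs, e, edgePoint_val h ht]

theorem mem_pointsOf_edgePoint {u v : V} (h : G.Adj u v) {s : ℝ} (hs : s ∈ Ioo (0 : ℝ) 1)
    (H : G.Subgraph) : edgePoint h s ∈ pointsOf H ↔ H.Adj u v := by
  rw [pointsOf, mem_ofPred_eq, edgePoint_val h (Ioo_subset_Icc_self hs),
    edgeMap_mem_polyhedron_iff h.ne hs]

theorem mem_Ioo_of_not_isVertexPoint {u v : V} {h : G.Adj u v} {s : ℝ} (hs : s ∈ Icc (0 : ℝ) 1)
    (hv : ¬ IsVertexPoint (edgePoint h s)) : s ∈ Ioo (0 : ℝ) 1 := by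
  refine ⟨lt_of_le_of_ne hs.1 ?_, lt_of_le_of_ne hs.2 ?_⟩
  · rintro rfl
    exact hv ⟨u, by rw [edgePoint_val h hs, edgeMap_zero]⟩
  · rintro rfl
    exact hv ⟨v, by rw [edgePoint_val h hs, edgeMap_one]⟩

theorem exists_edgePoint_of_not_isVertexPoint {x : Realization G} (hx : ¬ IsVertexPoint x) :
    ∃ (u v : V) (h : G.Adj u v), ∃ s ∈ Ioo (0 : ℝ) 1, x = edgePoint h s := by
  rcases x.2 with ⟨v, -, e⟩ | ⟨u, v, huv, hs⟩
  · exact absurd ⟨v, e⟩ hx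
  · rw [SimpleGraph.Subgraph.top_adj] at huv
    obtain ⟨s, hs, e⟩ := exists_edgeMap_of_mem_segment hs
    have e' : x = edgePoint huv s := Subtype.ext (by rw [e, edgePoint_val huv hs])
    exact ⟨u, v, huv, s, mem_Ioo_of_not_isVertexPoint hs (e' ▸ hx), e'⟩

theorem exists_edgePoint_symm {u v : V} (h : G.Adj u v) {s : ℝ} (hs : s ∈ Ioo (0 : ℝ) 1) :
    ∃ t ∈ Ioo (0 : ℝ) 1, edgePoint h s = edgePoint h.symm t := by
  have hs' : 1 - s ∈ Ioo (0 : ℝ) 1 := ⟨by linarith [hs.2], by linarith [hs.1]⟩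
  refine ⟨1 - s, hs', Subtype.ext ?_⟩
  rw [edgePoint_val h (Ioo_subset_Icc_self hs), edgePoint_val _ (Ioo_subset_Icc_self hs'), edgeMap,
    edgeMap, sub_sub_cancel, add_comm]

/-- The identification of the plane with the complex numbers. -/
noncomputable def toComplex : Plane ≃ₗᵢ[ℝ] ℂ := Complex.orthonormalBasisOneI.repr.symm

/-- The image of an edge as a path in the complex plane. -/
noncomputable def edgePath (f : Realization G → Plane) {u v : V} (h : G.Adj u v) (s : ℝ) : ℂ :=
  toComplex (f (edgePoint h s))

/-- The image of a vertex in the complex plane. -/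
noncomputable def vertexImage (f : Realization G → Plane) (v : V) : ℂ :=
  toComplex (f ⟨Pi.single v 1, .inl ⟨v, trivial, rfl⟩⟩)

theorem edgePath_zero (f : Realization G → Plane) {u v : V} (h : G.Adj u v) :
    edgePath f h 0 = vertexImage f u :=
  congrArg (fun x => toComplex (f x)) (Subtype.ext
    ((edgePoint_val h ⟨le_rfl, zero_le_one⟩).trans (edgeMap_zero u v)))

theorem edgePath_one (f : Realization G → Plane) {u v : V} (h : G.Adj u v) :
    edgePath f h 1 = vertexImage f v :=
  congrArg (fun x => toComplex (f x)) (Subtype.ext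
    ((edgePoint_val h ⟨zero_le_one, le_rfl⟩).trans (edgeMap_one u v)))

/-- The common points of the images of two edges. -/
def edgeCrossings (f : Realization G → Plane) {u v u' v' : V} (h : G.Adj u v) (h' : G.Adj u' v') :
    Set Plane :=
  {p | ∃ s ∈ Icc (0 : ℝ) 1, ∃ t ∈ Icc (0 : ℝ) 1, f (edgePoint h s) = p ∧ f (edgePoint h' t) = p}

namespace IsPlaneGenericImmersion

variable {f : Realization G → Plane} (hf : IsPlaneGenericImmersion f)
include hf

theorem continuous_edgePath {u v : V} (h : G.Adj u v) : Continuous (edgePath f h) :=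
  toComplex.continuous.comp (hf.continuous.comp (continuous_edgePoint h))

theorem vertexImage_injective : Function.Injective (vertexImage f) := by
  intro u v e
  by_contra hne
  refine hf.not_vertex _ _ (fun e' => ?_) (toComplex.injective e) ⟨u, rfl⟩
  have := congrFun (congrArg Subtype.val e') u
  simp [hne] at this

theorem edgePath_ne_vertexImage {u v w : V} (h : G.Adj u v) (hu : w ≠ u) (hv : w ≠ v) {s : ℝ}
    (hs : s ∈ Icc (0 : ℝ) 1) : edgePath f h s ≠ vertexImage f w := by
  intro e
  refine hf.not_vertex _ _ (fun e' => ?_) (toComplex.injective e).symm ⟨w, rfl⟩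
  have := congrFun (congrArg Subtype.val e') w
  rw [edgePoint_val h hs, edgeMap_apply_of_ne hu hv] at this
  simp at this

/-- In the coordinates of a transversal crossing, the branch contained in a coordinate axis is
parametrized injectively. -/
theorem exists_axis_parametrization {u v : V} (h : G.Adj u v) {s₀ : ℝ} (hs : s₀ ∈ Ioo (0 : ℝ) 1)
    (φ : OpenPartialHomeomorph Plane Plane) (hφ : f (edgePoint h s₀) ∈ φ.source)
    (hφ0 : φ (f (edgePoint h s₀)) = 0) {i j : Fin 2} (hij : i ≠ j)
    (hax : ∀ᶠ z in 𝓝 (edgePoint h s₀), φ (f z) j = 0) :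
    ∃ α : ℝ → ℝ, α s₀ = 0 ∧ ∃ δ > 0, ∀ δ', 0 < δ' → δ' ≤ δ →
      ContinuousOn α (Icc (s₀ - δ') (s₀ + δ')) ∧ InjOn α (Icc (s₀ - δ') (s₀ + δ')) ∧
      ∀ s ∈ Icc (s₀ - δ') (s₀ + δ'),
        f (edgePoint h s) = φ.symm (EuclideanSpace.single i (α s)) := by
  obtain ⟨U, hU, hxU, hinj⟩ := hf.locallyInjective (edgePoint h s₀)
  have hcont : Continuous fun s => f (edgePoint h s) :=
    hf.continuous.comp (continuous_edgePoint h)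
  have ev1 := (continuous_edgePoint h).continuousAt.eventually hax
  have ev2 := (continuous_edgePoint h).continuousAt.eventually (hU.mem_nhds hxU)
  have ev3 := hcont.continuousAt.eventually (φ.open_source.mem_nhds hφ)
  have ev4 : ∀ᶠ s in 𝓝 s₀, s ∈ Ioo (0 : ℝ) 1 := Ioo_mem_nhds hs.1 hs.2
  obtain ⟨ε, hε, hball⟩ := Metric.eventually_nhds_iff.1 (ev1.and (ev2.and (ev3.and ev4)))
  refine ⟨fun s => φ (f (edgePoint h s)) i, by simp [hφ0], ε / 2, by linarith,
    fun δ' h0 hle => ?_⟩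
  have hB : ∀ s ∈ Icc (s₀ - δ') (s₀ + δ'), dist s s₀ < ε := fun s hs => by
    rw [Real.dist_eq, abs_lt]
    constructor <;> linarith [hs.1, hs.2]
  have hval : ∀ s ∈ Icc (s₀ - δ') (s₀ + δ'),
      φ (f (edgePoint h s)) = EuclideanSpace.single i (φ (f (edgePoint h s)) i) := by
    intro s hs
    have := (hball (hB s hs)).1
    ext l
    by_cases hl : l = i
    · simp [hl]
    · have : l = j := by omega
      subst this
      simpa [hl] using (hball (hB s hs)).1
  refine ⟨?_, ?_, ?_⟩
  · have h1 : ContinuousOn (fun s => φ (f (edgePoint h s))) (Icc (s₀ - δ') (s₀ + δ')) :=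
      φ.continuousOn.comp hcont.continuousOn fun s hs => (hball (hB s hs)).2.2.1
    exact (EuclideanSpace.proj (𝕜 := ℝ) i).continuous.comp_continuousOn h1
  · intro s hs t ht e
    obtain ⟨-, a1, a2, a3⟩ := hball (hB s hs)
    obtain ⟨-, b1, b2, b3⟩ := hball (hB t ht)
    have e1 : φ (f (edgePoint h s)) = φ (f (edgePoint h t)) := by
      rw [hval s hs, hval t ht]
      exact congrArg _ e
    exact edgePoint_injOn h (Ioo_subset_Icc_self a3) (Ioo_subset_Icc_self b3)
      (hinj a1 b1 (φ.injOn a2 b2 e1))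
  · intro s hs
    rw [← hval s hs, φ.left_inv (hball (hB s hs)).2.2.1]

/-- The inverse of the transversality chart, restricted to a small square around the origin, serves
as `k` in `exists_holonomy_eq_neg_one`. -/
theorem hasOddHolonomyAt {u v u' v' : V} (h : G.Adj u v) (h' : G.Adj u' v')
    {s₀ t₀ : ℝ} (hs : s₀ ∈ Ioo (0 : ℝ) 1) (ht : t₀ ∈ Ioo (0 : ℝ) 1)
    (hne : edgePoint h s₀ ≠ edgePoint h' t₀) (e : f (edgePoint h s₀) = f (edgePoint h' t₀)) :
    HasOddHolonomyAt (fun s t => edgePath f h s - edgePath f h' t) s₀ t₀ := by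
  obtain ⟨-, φ, hφ, hφ0, hx, hy⟩ := hf.transversal _ _ hne e
  obtain ⟨α, hα0, δ₁, hδ₁, hα⟩ := hf.exists_axis_parametrization h hs φ hφ hφ0
    (i := 0) (j := 1) (by decide) hx
  obtain ⟨β, hβ0, δ₂, hδ₂, hβ⟩ := hf.exists_axis_parametrization h' ht φ (e ▸ hφ) (e ▸ hφ0)
    (i := 1) (j := 0) (by decide) hy
  have h0 : (0 : Plane) ∈ φ.target := hφ0 ▸ φ.map_source hφ
  let ι : ℝ × ℝ → Plane := fun x => !₂[x.1, x.2]
  have hι : Continuous ι := by fun_prop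
  have hιinj : Function.Injective ι := fun x y hxy => by
    have h1 := congrArg (fun z : Plane => z 0) hxy
    have h2 := congrArg (fun z : Plane => z 1) hxy
    simp only [ι] at h1 h2
    exact Prod.ext (by simpa using h1) (by simpa using h2)
  have hι0 : ι (0, 0) = 0 := by
    ext i
    fin_cases i <;> simp [ι]
  have hnhds : ∀ᶠ x in 𝓝 ((0 : ℝ), (0 : ℝ)), ι x ∈ φ.target :=
    hι.continuousAt.eventually (by rw [hι0]; exact φ.open_target.mem_nhds h0)
  obtain ⟨ε, hε, hball⟩ := Metric.eventually_nhds_iff.1 hnhds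
  have hsq : ∀ x ∈ Icc (-(ε / 2)) (ε / 2) ×ˢ Icc (-(ε / 2)) (ε / 2), ι x ∈ φ.target := by
    intro x hx
    refine hball ?_
    rw [Prod.dist_eq, max_lt_iff, Real.dist_eq, Real.dist_eq, sub_zero, sub_zero, abs_lt, abs_lt]
    obtain ⟨⟨h1, h2⟩, h3, h4⟩ := hx
    refine ⟨⟨?_, ?_⟩, ?_, ?_⟩ <;> linarith
  have ax0 : ∀ a : ℝ, EuclideanSpace.single (0 : Fin 2) a = ι (a, 0) := fun a => by
    ext i
    fin_cases i <;> simp [ι]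
  have ax1 : ∀ a : ℝ, EuclideanSpace.single (1 : Fin 2) a = ι (0, a) := fun a => by
    ext i
    fin_cases i <;> simp [ι]
  intro η hη
  have hm : 0 < min η (min δ₁ δ₂) := lt_min hη (lt_min hδ₁ hδ₂)
  obtain ⟨hα1, hα2, hα3⟩ := hα _ hm ((min_le_right _ _).trans (min_le_left _ _))
  obtain ⟨hβ1, hβ2, hβ3⟩ := hβ _ hm ((min_le_right _ _).trans (min_le_right _ _))
  obtain ⟨s₁, s₂, t₁, t₂, c1, c2, c3, c4, c5, c6, c7, c8, hh⟩ :=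
    exists_holonomy_eq_neg_one (A := edgePath f h) (B := edgePath f h')
      (k := fun a b => toComplex (φ.symm (ι (a, b)))) (half_pos hε) hm
      (toComplex.continuous.comp_continuousOn
        (φ.symm.continuousOn.comp hι.continuousOn hsq))
      (fun x hx y hy hxy => hιinj (φ.symm.injOn (hsq x hx) (hsq y hy) (toComplex.injective hxy)))
      hα1 hα2 hα0 (fun s hs => by rw [← ax0, ← hα3 s hs]; rfl)
      hβ1 hβ2 hβ0 (fun s hs => by rw [← ax1, ← hβ3 s hs]; rfl)
  have hle := min_le_left η (min δ₁ δ₂)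
  exact ⟨s₁, s₂, t₁, t₂, by linarith, c2, c3, by linarith, by linarith, c6, c7, by linarith, hh⟩

/-- The parity of the number of crossings of two disjoint edges is the holonomy of the difference
of the two edges. -/
theorem holonomy_edges {u v u' v' : V} (h : G.Adj u v) (h' : G.Adj u' v') (h1 : u ≠ u')
    (h2 : u ≠ v') (h3 : v ≠ u') (h4 : v ≠ v') :
    holonomy (fun s t => edgePath f h s - edgePath f h' t) 0 1 0 1 =
      (-1) ^ (edgeCrossings f h h').ncard := by
  have hne : ∀ s ∈ Icc (0 : ℝ) 1, ∀ t ∈ Icc (0 : ℝ) 1, edgePoint h s ≠ edgePoint h' t :=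
    fun s hs t ht e => edgeMap_ne_of_disjoint h.ne h1 h2 h3 h4 s t <| by
      rw [← edgePoint_val h hs, e, edgePoint_val h' ht]
  let Z : Set (ℝ × ℝ) := {z | z.1 ∈ Icc (0 : ℝ) 1 ∧ z.2 ∈ Icc (0 : ℝ) 1 ∧
    f (edgePoint h z.1) = f (edgePoint h' z.2)}
  -- Otherwise there would be a triple point. This both identifies zeros with crossing points and
  -- makes the first coordinates of the zeros distinct.
  have hfst : ∀ z ∈ Z, ∀ w ∈ Z, f (edgePoint h z.1) = f (edgePoint h w.1) → z = w := by
    rintro ⟨s, t⟩ ⟨hs, ht, e⟩ ⟨s', t'⟩ ⟨hs', ht', e'⟩ heq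
    dsimp only at *
    refine Prod.ext ?_ ?_
    · rcases hf.double _ _ _ heq (e'.trans rfl) with c | c | c
      · exact edgePoint_injOn h hs hs' c
      · exact absurd c (hne _ hs' _ ht')
      · exact absurd c (hne _ hs _ ht')
    · rcases hf.double _ _ _ e (e.symm.trans (heq.trans e')) with c | c | c
      · exact absurd c (hne _ hs _ ht)
      · exact edgePoint_injOn h' ht ht' c
      · exact absurd c (hne _ hs _ ht')
  have himg : (fun z : ℝ × ℝ => f (edgePoint h z.1)) '' Z = edgeCrossings f h h' := by
    ext p
    constructor
    · rintro ⟨z, ⟨hs, ht, e⟩, rfl⟩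
      exact ⟨z.1, hs, z.2, ht, rfl, e.symm⟩
    · rintro ⟨s, hs, t, ht, e, e'⟩
      exact ⟨(s, t), ⟨hs, ht, e.trans e'.symm⟩, e⟩
  have hfin : Z.Finite := by
    refine Set.Finite.of_finite_image ?_ (fun z hz w hw e => hfst z hz w hw e)
    rw [himg]
    refine hf.finite_crossings.subset ?_
    rintro p ⟨s, hs, t, ht, e, e'⟩
    exact ⟨_, (edgePoint h s).2, _, (edgePoint h' t).2, hne s hs t ht, e, e'⟩
  have hint : ∀ z ∈ Z, z ∈ Ioo (0 : ℝ) 1 ×ˢ Ioo (0 : ℝ) 1 := fun z ⟨hs, ht, e⟩ =>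
    ⟨mem_Ioo_of_not_isVertexPoint hs (hf.not_vertex _ _ (hne _ hs _ ht) e),
      mem_Ioo_of_not_isVertexPoint ht (hf.not_vertex _ _ (hne _ hs _ ht).symm e.symm)⟩
  rw [← himg, InjOn.ncard_image fun z hz w hw e => hfst z hz w hw e,
    Set.ncard_eq_toFinset_card Z hfin]
  refine holonomy_eq_neg_one_pow_card zero_le_one _ hfin.toFinset rfl zero_le_one ?_ ?_ ?_ ?_ ?_
  · exact (((hf.continuous_edgePath h).comp continuous_fst).sub
      ((hf.continuous_edgePath h').comp continuous_snd)).continuousOn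
  · exact fun z hz => hint z (hfin.mem_toFinset.1 hz)
  · exact fun s hs t ht e => hfin.mem_toFinset.2
      ⟨hs, ht, toComplex.injective (sub_eq_zero.1 e)⟩
  · exact fun z hz w hw e => hfst z (hfin.mem_toFinset.1 hz) w (hfin.mem_toFinset.1 hw) (by rw [e])
  · intro z hz
    have hz' := hfin.mem_toFinset.1 hz
    exact hf.hasOddHolonomyAt h h' (hint z hz').1 (hint z hz').2
      (hne _ hz'.1 _ hz'.2.1) hz'.2.2

end IsPlaneGenericImmersion

end EdgePoints

end PlaneGraph

namespace PlaneGraph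

open Set

/-! ### Numbering of the Heawood graph and the combinatorics of pairs of edges at distance 2 -/

section Heawood

instance : DecidableRel heawood.Adj := fun a b =>
  match a, b with
  | .inl i, .inr j => inferInstanceAs (Decidable (j = i ∨ j = i - 1 ∨ j = i + 2))
  | .inr j, .inl i => inferInstanceAs (Decidable (j = i ∨ j = i - 1 ∨ j = i + 2))
  | .inl _, .inl _ => .isFalse id
  | .inr _, .inr _ => .isFalse id

/-- The vertices of the Heawood graph, numbered by `0, …, 13`: first the `u i`, then the `v i`. -/
def vertexOf (x : Fin 14) : ZMod 7 ⊕ ZMod 7 :=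
  if x.val < 7 then .inl (x.val : ZMod 7) else .inr (x.val : ZMod 7)

/-- The number of the end `u i` of an edge, where the edges `u i v i`, `u i v (i - 1)` and
`u i v (i + 2)` have the numbers `3 i`, `3 i + 1` and `3 i + 2`. -/
def edgeSrc (e : Fin 21) : Fin 14 := ⟨e.val / 3, by omega⟩

/-- The number of the end `v j` of an edge. -/
def edgeTgt (e : Fin 21) : Fin 14 :=
  -- The polynomial `2 r² + 4 r` takes the values `0, -1, 2` modulo 7 at `r = 0, 1, 2`.
  ⟨7 + (e.val / 3 + (2 * (e.val % 3) * (e.val % 3) + 4 * (e.val % 3))) % 7, by omega⟩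

theorem vertexOf_bijective : Function.Bijective vertexOf := by decide +kernel

theorem edgeSrc_ne_edgeTgt : ∀ e e' : Fin 21, edgeSrc e ≠ edgeTgt e' := by decide +kernel

theorem heawood_adj_edge : ∀ e : Fin 21,
    heawood.Adj (vertexOf (edgeSrc e)) (vertexOf (edgeTgt e)) := by decide +kernel

theorem exists_edge_of_heawood_adj : ∀ x y : Fin 14, heawood.Adj (vertexOf x) (vertexOf y) →
    ∃ e, (x = edgeSrc e ∧ y = edgeTgt e) ∨ (x = edgeTgt e ∧ y = edgeSrc e) := by decide +kernel

theorem edge_ext : ∀ e e' : Fin 21, edgeSrc e = edgeSrc e' → edgeTgt e = edgeTgt e' → e = e' := by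
  decide +kernel

/-- The vertices with the numbers `x < 7` and `y ≥ 7` are adjacent. -/
def IsLinked (x y : Fin 14) : Prop :=
  (y.val + 7 - x.val) % 7 = 0 ∨ (y.val + 7 - x.val) % 7 = 6 ∨ (y.val + 7 - x.val) % 7 = 2

instance : DecidableRel IsLinked := fun x y => by unfold IsLinked; infer_instance

theorem isLinked_edge : ∀ e, IsLinked (edgeSrc e) (edgeTgt e) := by decide +kernel

/-- The edges `e` and `e'` have distance `2`: no end of `e` is equal or adjacent to an
end of `e'`. -/
def IsFar (e e' : Fin 21) : Prop :=
  ¬IsLinked (edgeSrc e) (edgeTgt e') ∧ ¬IsLinked (edgeSrc e') (edgeTgt e)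

instance : DecidableRel IsFar := fun e e' => by unfold IsFar; infer_instance

theorem IsFar.symm {e e' : Fin 21} (h : IsFar e e') : IsFar e' e := And.symm h

/-- The unordered pairs of edges at distance `2`. -/
def farPairs : Finset (Fin 21 × Fin 21) := {d | d.1 < d.2 ∧ IsFar d.1 d.2}

theorem IsFar.src_ne {e e' : Fin 21} (h : IsFar e e') : edgeSrc e ≠ edgeSrc e' :=
  fun he => h.1 (he ▸ isLinked_edge e')

theorem IsFar.tgt_ne {e e' : Fin 21} (h : IsFar e e') : edgeTgt e ≠ edgeTgt e' :=
  fun he => h.1 (he ▸ isLinked_edge e)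

/-- The sign with which the sides parallel to `e` of the square spanned by the edges `e` and `e'`
enter its boundary; zero if the edges are not at distance `2`. -/
def farSign (e e' : Fin 21) : ℤ :=
  if IsFar e e' then if e < e' then 1 else if e' < e then -1 else 0 else 0

/-- The total exponent of the side `x × e` in the boundaries of all squares. -/
def sideExponent (x : Fin 14) (e : Fin 21) : ℤ :=
  ∑ e', farSign e e' * ((if x = edgeSrc e' then 1 else 0) - if x = edgeTgt e' then 1 else 0)

/-- The sign comparing the directions `x → y` and `min x y → max x y`. -/
def orderSign (x y : Fin 14) : ℤˣ := if x < y then 1 else -1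

/-- The squares of pairs at distance 2 close up modulo 2: every side lies in an even number of them.
This frees the total holonomy from the choice of `f`. -/
theorem sideExponent_even : ∀ x e, sideExponent x e = 2 * (sideExponent x e / 2) := by
  decide +kernel

/-- No edge at distance 2 from `e` touches `e`, so sides along which the difference would vanish do
not occur. -/
theorem sideExponent_eq_zero : ∀ e, sideExponent (edgeSrc e) e = 0 ∧
    sideExponent (edgeTgt e) e = 0 := by decide +kernel

/-- This finite product is the value of the obstruction; its being `-1` forces an odd number of
crossings. -/
theorem prod_orderSign : ∏ e, ∏ x,
    (orderSign x (edgeSrc e) * orderSign x (edgeTgt e)) ^ (sideExponent x e / 2) = -1 := by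
  decide +kernel

theorem prod_farPairs {M : Type*} [CommGroup M] (A : Fin 21 → Fin 21 → M) :
    ∏ d ∈ farPairs, A d.1 d.2 / A d.2 d.1 = ∏ e, ∏ e', A e e' ^ farSign e e' := by
  have h1 : ∀ e e', A e e' ^ farSign e e' =
      (if e < e' ∧ IsFar e e' then A e e' else 1) *
        (if e' < e ∧ IsFar e' e then (A e e')⁻¹ else 1) := by
    intro e e'
    rw [farSign]
    by_cases hf : IsFar e e'
    · have hs := hf.symm
      rcases lt_trichotomy e e' with h | h | h
      · simp [hf, h, h.not_gt]
      · subst h; simp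
      · simp [hf, hs, h, h.not_gt]
    · have hs : ¬IsFar e' e := fun h => hf h.symm
      simp [hf, hs]
  simp_rw [h1, Finset.prod_mul_distrib]
  rw [Finset.prod_comm (f := fun e e' => if e' < e ∧ IsFar e' e then (A e e')⁻¹ else 1),
    ← Finset.prod_mul_distrib]
  simp_rw [← Finset.prod_mul_distrib]
  rw [farPairs, Finset.prod_filter, Fintype.prod_prod_type]
  refine Finset.prod_congr rfl fun e _ => Finset.prod_congr rfl fun e' _ => ?_
  by_cases h : e < e' ∧ IsFar e e' <;> simp [h, div_eq_mul_inv]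

theorem zpow_sum_eq_prod {ι M : Type*} [CommGroup M] (a : M) (s : Finset ι) (n : ι → ℤ) :
    a ^ ∑ i ∈ s, n i = ∏ i ∈ s, a ^ n i := by
  classical
  induction s using Finset.induction_on with
  | empty => simp
  | insert i s hi ih => rw [Finset.sum_insert hi, Finset.prod_insert hi, zpow_add, ih]

/-- The boundary contributions of all squares are regrouped by sides, which turns the product of
holonomies into powers with the exponents `sideExponent`. -/
theorem prod_sides {M : Type*} [CommGroup M] (σ : Fin 14 → Fin 21 → M) :
    ∏ d ∈ farPairs, (σ (edgeSrc d.2) d.1 / σ (edgeTgt d.2) d.1) /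
      (σ (edgeSrc d.1) d.2 / σ (edgeTgt d.1) d.2) = ∏ e, ∏ x, σ x e ^ sideExponent x e := by
  rw [prod_farPairs fun e e' => σ (edgeSrc e') e / σ (edgeTgt e') e]
  refine Finset.prod_congr rfl fun e _ => ?_
  have h1 : ∀ (y : Fin 14) (n : ℤ), σ y e ^ n = ∏ x, σ x e ^ (n * if x = y then 1 else 0) := by
    intro y n
    rw [Finset.prod_eq_single y] <;> simp +contextual
  simp_rw [sideExponent, zpow_sum_eq_prod]
  rw [Finset.prod_comm]
  refine Finset.prod_congr rfl fun e' _ => ?_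
  rw [div_zpow, h1, h1 (edgeTgt e'), ← Finset.prod_div_distrib]
  refine Finset.prod_congr rfl fun x _ => ?_
  rw [mul_sub, zpow_sub, div_eq_mul_inv]

/-- Only the squares of the `σ x e` enter, because the exponents are even, and these squares are
prescribed signs. Where `x` is an end of `e` nothing is known about `σ`, but the exponent is zero.
-/
theorem prod_sides_eq_neg_one (σ : Fin 14 → Fin 21 → ℂˣ)
    (hσ : ∀ x e, x ≠ edgeSrc e → x ≠ edgeTgt e → σ x e ^ 2 =
      Units.map (Int.castRingHom ℂ) (orderSign x (edgeSrc e) * orderSign x (edgeTgt e))) :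
    ∏ d ∈ farPairs, (σ (edgeSrc d.2) d.1 / σ (edgeTgt d.2) d.1) /
      (σ (edgeSrc d.1) d.2 / σ (edgeTgt d.1) d.2) = -1 := by
  have h1 : ∀ x e, σ x e ^ sideExponent x e = Units.map (Int.castRingHom ℂ).toMonoidHom
      ((orderSign x (edgeSrc e) * orderSign x (edgeTgt e)) ^ (sideExponent x e / 2)) := by
    intro x e
    by_cases h : x = edgeSrc e ∨ x = edgeTgt e
    · have h0 : sideExponent x e = 0 := by
        rcases h with rfl | rfl
        exacts [(sideExponent_eq_zero e).1, (sideExponent_eq_zero e).2]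
      simp [h0]
    · rw [not_or] at h
      rw [map_zpow]
      conv_lhs => rw [sideExponent_even x e, zpow_mul]
      congr 1
      exact hσ x e h.1 h.2
  rw [prod_sides]
  simp_rw [h1, ← map_prod, prod_orderSign]
  ext
  simp

end Heawood

end PlaneGraph

namespace PlaneGraph

open Set

/-! ### The total holonomy over pairs of edges at distance 2 -/

section HeawoodHolonomy

/-- A square root of the difference of the later and the earlier of two points. -/
noncomputable def directionSqrt (g : Fin 14 → ℂ) (x y : Fin 14) : ℂ :=
  if x = y then 1 else (g (max x y) - g (min x y)) ^ ((2 : ℕ) : ℂ)⁻¹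

/-- The symmetry makes the corner factors of each square cancel; its price is the sign in
`directionSqrt_sq`. -/
theorem directionSqrt_comm (g : Fin 14 → ℂ) (x y : Fin 14) :
    directionSqrt g x y = directionSqrt g y x := by
  simp only [directionSqrt, max_comm x y, min_comm x y, eq_comm]

theorem directionSqrt_sq {g : Fin 14 → ℂ} {x y : Fin 14} (h : x ≠ y) :
    directionSqrt g x y ^ 2 = ((orderSign x y : ℤ) : ℂ) * (g y - g x) := by
  rw [directionSqrt, if_neg h, Complex.cpow_nat_inv_pow _ two_ne_zero, orderSign]
  rcases lt_or_gt_of_ne h with h | h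
  · simp [h, max_eq_right h.le, min_eq_left h.le]
  · simp [h.not_gt, max_eq_left h.le, min_eq_right h.le]

theorem directionSqrt_ne_zero {g : Fin 14 → ℂ} (hg : Function.Injective g) (x y : Fin 14) :
    directionSqrt g x y ≠ 0 := by
  by_cases h : x = y
  · rw [directionSqrt, if_pos h]
    exact one_ne_zero
  · intro h0
    have := directionSqrt_sq (g := g) h
    rw [h0, zero_pow two_ne_zero, eq_comm, mul_eq_zero, sub_eq_zero] at this
    rcases this with h1 | h1
    · exact (orderSign x y).ne_zero (by exact_mod_cast h1)
    · exact h (hg h1.symm)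

namespace IsPlaneGenericImmersion

variable {f : Realization heawood → Plane} (hf : IsPlaneGenericImmersion f)
include hf

theorem isPuncturedPath_sub_vertex {x : Fin 14} {e : Fin 21} (hs : x ≠ edgeSrc e)
    (ht : x ≠ edgeTgt e) : IsPuncturedPath (fun s => edgePath f (heawood_adj_edge e) s -
      vertexImage f (vertexOf x)) 0 1 := by
  refine ⟨((hf.continuous_edgePath _).sub continuous_const).continuousOn, fun s h => ?_⟩
  rw [uIcc_of_le zero_le_one] at h
  exact sub_ne_zero.2 (hf.edgePath_ne_vertexImage _ (fun h => hs (vertexOf_bijective.1 h))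
    (fun h => ht (vertexOf_bijective.1 h)) h)

/-- The number of crossings between edges of the Heawood graph at distance `2` is odd. -/
theorem odd_sum_farPairs : Odd (∑ d ∈ farPairs,
    (edgeCrossings f (heawood_adj_edge d.1) (heawood_adj_edge d.2)).ncard) := by
  set g : Fin 14 → ℂ := fun x => vertexImage f (vertexOf x)
  have hg : Function.Injective g := hf.vertexImage_injective.comp vertexOf_bijective.1
  have hr := directionSqrt_ne_zero hg
  set r := directionSqrt g
  set T : Fin 14 → Fin 21 → ℂ := fun x e =>
    sqrtTransport (fun s => edgePath f (heawood_adj_edge e) s - g x) 0 1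
  have hT0 : ∀ x e, T x e ≠ 0 := fun x e => sqrtTransport_ne_zero _ _ _
  -- Correcting the transport by the chosen roots at both ends of the side leaves the holonomy of
  -- each square unchanged and turns the square of each relevant factor into a sign.
  set σ : Fin 14 → Fin 21 → ℂˣ := fun x e =>
    Units.mk0 (T x e * r x (edgeSrc e) / r x (edgeTgt e))
      (div_ne_zero (mul_ne_zero (hT0 x e) (hr _ _)) (hr _ _)) with hσ
  have key := prod_sides_eq_neg_one σ ?_
  · have hol : ∀ d ∈ farPairs, (((σ (edgeSrc d.2) d.1 / σ (edgeTgt d.2) d.1) /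
        (σ (edgeSrc d.1) d.2 / σ (edgeTgt d.1) d.2) : ℂˣ) : ℂ) =
        (-1) ^ (edgeCrossings f (heawood_adj_edge d.1) (heawood_adj_edge d.2)).ncard := by
      rintro ⟨a, b⟩ hd
      have hfar : IsFar a b := (Finset.mem_filter.1 hd).2.2
      have ss := hfar.src_ne
      have tt := hfar.tgt_ne
      have st := edgeSrc_ne_edgeTgt a b
      have ts := (edgeSrc_ne_edgeTgt b a).symm
      have inj := vertexOf_bijective.1
      rw [← hf.holonomy_edges (heawood_adj_edge a) (heawood_adj_edge b) (inj.ne ss) (inj.ne st)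
        (inj.ne ts) (inj.ne tt), holonomy]
      simp only [edgePath_zero, edgePath_one]
      have n1 : sqrtTransport (fun t => vertexImage f (vertexOf (edgeTgt a)) -
          edgePath f (heawood_adj_edge b) t) 0 1 = T (edgeTgt a) b := by
        have := (hf.isPuncturedPath_sub_vertex ts tt).sqrtTransport_neg
        simp only [neg_sub] at this
        exact this
      have n2 : sqrtTransport (fun t => vertexImage f (vertexOf (edgeSrc a)) -
          edgePath f (heawood_adj_edge b) t) 0 1 = T (edgeSrc a) b := by
        have := (hf.isPuncturedPath_sub_vertex ss st).sqrtTransport_neg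
        simp only [neg_sub] at this
        exact this
      rw [n1, n2]
      change _ = T (edgeSrc b) a * _ / (T (edgeTgt b) a * _)
      simp only [hσ, Units.val_div_eq_div_val, Units.val_mk0]
      rw [show r (edgeSrc b) (edgeSrc a) = r (edgeSrc a) (edgeSrc b) from directionSqrt_comm _ _ _,
        show r (edgeSrc b) (edgeTgt a) = r (edgeTgt a) (edgeSrc b) from directionSqrt_comm _ _ _,
        show r (edgeTgt b) (edgeTgt a) = r (edgeTgt a) (edgeTgt b) from directionSqrt_comm _ _ _,
        show r (edgeTgt b) (edgeSrc a) = r (edgeSrc a) (edgeTgt b) from directionSqrt_comm _ _ _]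
      have := hT0 (edgeTgt b) a
      have := hT0 (edgeSrc a) b
      have := hT0 (edgeTgt a) b
      have := hr (edgeSrc a) (edgeSrc b)
      have := hr (edgeTgt a) (edgeSrc b)
      have := hr (edgeTgt a) (edgeTgt b)
      have := hr (edgeSrc a) (edgeTgt b)
      field_simp
    have h1 := congrArg (Units.val) key
    rw [Units.coe_prod, Finset.prod_congr rfl hol, Finset.prod_pow_eq_pow_sum, Units.val_neg,
      Units.val_one] at h1
    by_contra hodd
    rw [Nat.not_odd_iff_even] at hodd
    rw [hodd.neg_one_pow] at h1
    norm_num at h1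
  · intro x e hs ht
    have hp := (hf.isPuncturedPath_sub_vertex hs ht).sq_sqrtTransport
    simp only [edgePath_zero, edgePath_one] at hp
    ext
    simp only [hσ, Units.val_pow_eq_pow_val, Units.val_mk0]
    rw [div_pow, mul_pow, directionSqrt_sq hs, directionSqrt_sq ht]
    change T x e ^ 2 = (g (edgeTgt e) - g x) / (g (edgeSrc e) - g x) at hp
    rw [hp]
    have m1 : g (edgeSrc e) - g x ≠ 0 := sub_ne_zero.2 (hg.ne hs.symm)
    have m2 : g (edgeTgt e) - g x ≠ 0 := sub_ne_zero.2 (hg.ne ht.symm)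
    have sq1 : ((orderSign x (edgeTgt e) : ℤ) : ℂ) * ((orderSign x (edgeTgt e) : ℤ) : ℂ) = 1 := by
      rw [← Int.cast_mul, ← Units.val_mul, Int.units_mul_self, Units.val_one, Int.cast_one]
    have m3 : ((orderSign x (edgeTgt e) : ℤ) : ℂ) ≠ 0 := left_ne_zero_of_mul_eq_one sq1
    simp only [map_mul, Units.val_mul, Units.coe_map]
    simp only [MonoidHom.coe_coe, eq_intCast]
    field_simp
    linear_combination -sq1

end IsPlaneGenericImmersion

end HeawoodHolonomy

end PlaneGraph

namespace PlaneGraph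

/-! ### The cycle space of the Heawood graph

Sets of edges are encoded by the binary digits of natural numbers. -/

/-- A basis of the cycle space, dual to the edges `0, 1, 3, 4, 6, 7, 9, 12` outside a spanning
tree. -/
def cycleBasis : List ℕ :=
  [166917, 789510, 1335336, 974896, 101696, 1671552, 813568, 905216]

/-- The elements of the cycle space. -/
def cycleSpace : List ℕ :=
  cycleBasis.foldr (fun b L => L ++ L.map (b ^^^ ·)) [0]

/-- The edges at the vertex number `x`. -/
def edgesAt (x : ℕ) : List ℕ :=
  if x < 7 then [3 * x, 3 * x + 1, 3 * x + 2]
  else [3 * (x % 7), 3 * ((x + 1) % 7) + 1, 3 * ((x + 5) % 7) + 2]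

/-- The end of the edge number `e` different from the vertex number `x`. -/
def otherEnd (e x : ℕ) : ℕ :=
  e / 3 + (7 + (e / 3 + (2 * (e % 3) * (e % 3) + 4 * (e % 3))) % 7) - x

/-- The vertices visited by the walk along the edges in `m` that arrives at `x` along `e`, until
it comes back to `start`. -/
def traceFrom (m start : ℕ) : ℕ → ℕ → ℕ → List ℕ
  | 0, _, _ => []
  | n + 1, e, x =>
    if x = start then [] else
      match (edgesAt x).find? fun a => m.testBit a && a != e with
      | none => []
      | some a => x :: traceFrom m start n a (otherEnd a x)

/-- The vertices of the cycle in `m` through the edge of `m` with the largest number. -/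
def traceCycle (m : ℕ) : List (Fin 14) :=
  (m.log2 / 3 :: traceFrom m (m.log2 / 3) 14 m.log2 (otherEnd m.log2 (m.log2 / 3))).map
    (Fin.ofNat 14)

/-- The elements of the cycle space that are cycles with `k` edges. -/
def cycleMasks (k : ℕ) : List ℕ :=
  cycleSpace.filter fun m => m != 0 && ((traceCycle m).length == k &&
    (List.finRange 21).all fun e => !m.testBit e || (traceCycle m).elem (edgeSrc e))

/-- `m` is the edge set of the closed walk with vertices `l`. -/
def IsTracedBy (m : ℕ) (l : List (Fin 14)) : Prop :=
  l.Nodup ∧ 3 ≤ l.length ∧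
    (l ++ l.take 1).IsChain (fun x y => heawood.Adj (vertexOf x) (vertexOf y)) ∧
    ∀ e : Fin 21, m.testBit e = true ↔
    (edgeSrc e, edgeTgt e) ∈ (l ++ l.take 1).zip (l ++ l.take 1).tail ∨
    (edgeTgt e, edgeSrc e) ∈ (l ++ l.take 1).zip (l ++ l.take 1).tail

instance (m : ℕ) (l : List (Fin 14)) : Decidable (IsTracedBy m l) := by
  unfold IsTracedBy; infer_instance

theorem nodup_cycleSpace : cycleSpace.Nodup := by decide +kernel

theorem lt_of_mem_cycleSpace : ∀ m ∈ cycleSpace, m < 2 ^ 21 := by decide +kernel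

/-- The graph is cubic, so an element of the cycle space is a disjoint union of cycles, and tracing
runs through exactly one of these components. -/
theorem traceCycle_closed : ∀ m ∈ cycleSpace, m ≠ 0 →
    (∃ e : Fin 21, m.testBit e = true ∧ edgeSrc e ∈ traceCycle m) ∧
    ∀ e : Fin 21, m.testBit e = true → (edgeSrc e ∈ traceCycle m ↔ edgeTgt e ∈ traceCycle m) := by
  decide +kernel

theorem isTracedBy_traceCycle : ∀ m ∈ cycleSpace, m ≠ 0 →
    (∀ e : Fin 21, m.testBit e = true → edgeSrc e ∈ traceCycle m) →
    IsTracedBy m (traceCycle m) := by decide +kernel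

/-- Each equation is the parity condition at one vertex; thirteen vertices suffice, and the eight
free bits are the edges to which the basis is dual. Stating each equation as soon as its bits are
bound prunes the decision to `2 ^ 8` final cases. -/
theorem ofBits_mem_cycleSpace_of_parity :
    ∀ b0 b1 b2 : Bool, b2 = (b0 ^^ b1) →
    ∀ b3 b4 b5 : Bool, b5 = (b3 ^^ b4) →
    ∀ b17 : Bool, b17 = (b0 ^^ b4) →
    ∀ b6 b10 : Bool, b10 = (b2 ^^ b6) →
    ∀ b7 b8 : Bool, b8 = (b6 ^^ b7) →
    ∀ b20 : Bool, b20 = (b3 ^^ b7) →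
    ∀ b9 b11 : Bool, b11 = (b9 ^^ b10) →
    ∀ b13 : Bool, b13 = (b5 ^^ b9) →
    ∀ b12 b14 : Bool, b14 = (b12 ^^ b13) →
    ∀ b16 : Bool, b16 = (b8 ^^ b12) →
    ∀ b18 : Bool, b18 = (b1 ^^ b14) →
    ∀ b15 : Bool, b15 = (b16 ^^ b17) →
    ∀ b19 : Bool, b19 = (b18 ^^ b20) →
    Nat.ofBits ![b0, b1, b2, b3, b4, b5, b6, b7, b8, b9, b10, b11, b12, b13, b14, b15, b16, b17,
      b18, b19, b20] ∈ cycleSpace := by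
  decide +kernel

/-- The case `e = e'`, where the count is even, accounts for self-crossings of an edge. -/
theorem countP_cycleMasks_odd : ∀ k ∈ [6, 8, 10], ∀ e e' : Fin 21,
    ((cycleMasks k).countP fun m => m.testBit e && m.testBit e') % 2 =
      if IsFar e e' then 1 else 0 := by
  decide +kernel

theorem countP_cycleMasks_twelve : ∀ e e' : Fin 21,
    ((cycleMasks 12).countP fun m => m.testBit e && m.testBit e') % 4 = 0 := by
  decide +kernel

theorem countP_cycleMasks_fourteen : ∀ e e' : Fin 21,
    ((cycleMasks 14).countP fun m => m.testBit e && m.testBit e') % 2 = 0 := by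
  decide +kernel

end PlaneGraph

/-! ### The correspondence between `k`-cycles and their codes -/

namespace PlaneGraph

theorem mem_cycleMasks {m k : ℕ} : m ∈ cycleMasks k ↔ m ∈ cycleSpace ∧ m ≠ 0 ∧
    (traceCycle m).length = k ∧ ∀ e : Fin 21, m.testBit e = true → edgeSrc e ∈ traceCycle m := by
  simp [cycleMasks, List.mem_filter, imp_iff_not_or]

theorem eq_of_mem_cycleSpace {m m' : ℕ} (hm : m ∈ cycleSpace) (hm' : m' ∈ cycleSpace)
    (h : ∀ e : Fin 21, m.testBit e = m'.testBit e) : m = m' := by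
  refine Nat.eq_of_testBit_eq fun i => ?_
  by_cases hi : i < 21
  · exact h ⟨i, hi⟩
  · have hle : 2 ^ 21 ≤ 2 ^ i := Nat.pow_le_pow_right two_pos (by omega)
    rw [Nat.testBit_lt_two_pow ((lt_of_mem_cycleSpace m hm).trans_le hle),
      Nat.testBit_lt_two_pow ((lt_of_mem_cycleSpace m' hm').trans_le hle)]

section Walks

variable {V : Type*} {G : SimpleGraph V}

theorem mem_edges_iff_mem_zip_support {u v : V} (w : G.Walk u v) (x y : V) :
    s(x, y) ∈ w.edges ↔ (x, y) ∈ w.support.zip w.support.tail ∨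
      (y, x) ∈ w.support.zip w.support.tail := by
  induction w with
  | nil => simp
  | @cons a b c h p ih =>
    have hz : (SimpleGraph.Walk.cons h p).support.zip (SimpleGraph.Walk.cons h p).support.tail =
        (a, b) :: p.support.zip p.support.tail := by
      rw [SimpleGraph.Walk.support_cons, List.tail_cons]
      conv_lhs => rw [← SimpleGraph.Walk.cons_tail_support p, List.zip_cons_cons,
        SimpleGraph.Walk.cons_tail_support p]
    rw [hz, SimpleGraph.Walk.edges_cons, List.mem_cons, List.mem_cons, List.mem_cons, ih,
      Sym2.eq_iff, Prod.mk.injEq, Prod.mk.injEq]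
    tauto

theorem exists_walk_of_isChain {l : List V} (hl : l ≠ []) (hc : l.IsChain G.Adj) {a b : V}
    (ha : l.head hl = a) (hb : l.getLast hl = b) : ∃ w : G.Walk a b, w.support = l := by
  subst ha hb
  exact ⟨_, SimpleGraph.Walk.support_ofSupport hl hc⟩

/-- Connectedness of a walk, in the form that lets a set closed under the edges of a cycle contain
all of its vertices. -/
theorem iff_of_mem_support {P : V → Prop} {u v : V} (w : G.Walk u v)
    (h : ∀ x y, s(x, y) ∈ w.edges → (P x ↔ P y)) : ∀ z ∈ w.support, (P z ↔ P u) := by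
  induction w with
  | nil => simp
  | @cons a b c hab p ih =>
    have hab' : P a ↔ P b := h a b (by simp)
    intro z hz
    rw [SimpleGraph.Walk.support_cons, List.mem_cons] at hz
    rcases hz with rfl | hz
    · rfl
    · rw [hab', ih (fun x y hxy => h x y (by simp [hxy])) z hz]

theorem length_eq_of_toSubgraph_eq {u v : V} {w : G.Walk u u} {w' : G.Walk v v} (hw : w.IsCycle)
    (hw' : w'.IsCycle) (h : w.toSubgraph = w'.toSubgraph) : w.length = w'.length := by
  classical
  rw [← w.length_edges, ← w'.length_edges, ← List.toFinset_card_of_nodup hw.edges_nodup,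
    ← List.toFinset_card_of_nodup hw'.edges_nodup]
  congr 1
  ext e
  rw [List.mem_toFinset, List.mem_toFinset, ← SimpleGraph.Walk.mem_edges_toSubgraph, h,
    SimpleGraph.Walk.mem_edges_toSubgraph]

theorem mem_verts_iff_exists_adj_of_mem_kCycles {H : G.Subgraph} {k : ℕ} (hH : H ∈ kCycles G k)
    (x : V) : x ∈ H.verts ↔ ∃ y, H.Adj x y := by
  refine ⟨fun hx => ?_, fun ⟨y, hy⟩ => hy.fst_mem⟩
  obtain ⟨v, w, hw, -, rfl⟩ := hH
  have h2 := hw.ncard_neighborSet_toSubgraph_eq_two (w.mem_verts_toSubgraph.1 hx)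
  obtain ⟨y, hy⟩ := Set.nonempty_of_ncard_ne_zero (s := w.toSubgraph.neighborSet x) (by omega)
  exact ⟨y, hy⟩

open Classical in
/-- A cycle contains an even number of the edges at a vertex of degree three. -/
theorem parity_of_mem_kCycles {H : G.Subgraph} {k : ℕ} (hH : H ∈ kCycles G k) {x a b c : V}
    (hab : a ≠ b) (hac : a ≠ c) (hbc : b ≠ c) (hx : ∀ y, G.Adj x y → y = a ∨ y = b ∨ y = c) :
    decide (H.Adj x a) = (decide (H.Adj x b) ^^ decide (H.Adj x c)) := by
  have hN : H.neighborSet x = ↑(({a, b, c} : Finset V).filter (H.Adj x)) := by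
    ext y
    simp only [SimpleGraph.Subgraph.mem_neighborSet, Finset.coe_filter, Finset.mem_insert,
      Finset.mem_singleton, Set.mem_ofPred_eq]
    exact ⟨fun h => ⟨hx y h.adj_sub, h⟩, fun h => h.2⟩
  have hcard : (H.neighborSet x).ncard = 2 ∨ (H.neighborSet x).ncard = 0 := by
    obtain ⟨v, w, hw, -, rfl⟩ := hH
    by_cases hv : x ∈ w.toSubgraph.verts
    · exact .inl (hw.ncard_neighborSet_toSubgraph_eq_two (w.mem_verts_toSubgraph.1 hv))
    · refine .inr ?_
      rw [Set.eq_empty_of_forall_notMem (s := w.toSubgraph.neighborSet x)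
        fun y hy => hv (SimpleGraph.Subgraph.Adj.fst_mem hy), Set.ncard_empty]
  rw [hN, Set.ncard_coe_finset] at hcard
  by_cases h1 : H.Adj x a <;> by_cases h2 : H.Adj x b <;> by_cases h3 : H.Adj x c <;>
    simp_all [Finset.filter_insert, Finset.filter_singleton]

end Walks

/-- The edge number `e` of the Heawood graph belongs to the subgraph `H`. -/
def HasEdge (H : heawood.Subgraph) (e : Fin 21) : Prop :=
  H.Adj (vertexOf (edgeSrc e)) (vertexOf (edgeTgt e))

theorem exists_hasEdge_of_adj {H : heawood.Subgraph} {x y : Fin 14}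
    (h : H.Adj (vertexOf x) (vertexOf y)) :
    ∃ e, HasEdge H e ∧ ((x = edgeSrc e ∧ y = edgeTgt e) ∨ (x = edgeTgt e ∧ y = edgeSrc e)) := by
  obtain ⟨e, he⟩ := exists_edge_of_heawood_adj x y h.adj_sub
  refine ⟨e, ?_, he⟩
  rcases he with ⟨rfl, rfl⟩ | ⟨rfl, rfl⟩
  exacts [h, h.symm]

/-- A cycle has no isolated vertices, so its edges determine it. -/
theorem eq_of_hasEdge_iff {H H' : heawood.Subgraph} {k k' : ℕ} (hH : H ∈ kCycles heawood k)
    (hH' : H' ∈ kCycles heawood k') (h : ∀ e, HasEdge H e ↔ HasEdge H' e) : H = H' := by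
  have hle : ∀ {H H' : heawood.Subgraph}, (∀ e, HasEdge H e → HasEdge H' e) →
      ∀ {x y}, H.Adj x y → H'.Adj x y := by
    intro H H' h x y hxy
    obtain ⟨x, rfl⟩ := vertexOf_bijective.2 x
    obtain ⟨y, rfl⟩ := vertexOf_bijective.2 y
    obtain ⟨e, he, ⟨rfl, rfl⟩ | ⟨rfl, rfl⟩⟩ := exists_hasEdge_of_adj hxy
    exacts [h e he, (h e he).symm]
  have hadj : ∀ x y, H.Adj x y ↔ H'.Adj x y := fun x y =>
    ⟨hle fun e => (h e).1, hle fun e => (h e).2⟩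
  refine SimpleGraph.Subgraph.ext ?_ ?_
  · ext x
    rw [mem_verts_iff_exists_adj_of_mem_kCycles hH, mem_verts_iff_exists_adj_of_mem_kCycles hH']
    simp only [hadj]
  · funext x y
    exact propext (hadj x y)

theorem exists_kCycle_of_isTracedBy {m : ℕ} {l : List (Fin 14)} (h : IsTracedBy m l) :
    ∃ H ∈ kCycles heawood l.length, ∀ e : Fin 21, HasEdge H e ↔ m.testBit e = true := by
  obtain ⟨hnd, hlen, hch, hbits⟩ := h
  obtain ⟨a, l, rfl⟩ := List.exists_cons_of_length_pos (l := l) (by omega)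
  have htake : (a :: l) ++ (a :: l).take 1 = a :: (l ++ [a]) := by simp
  rw [htake] at hch hbits
  obtain ⟨w, hw⟩ := exists_walk_of_isChain (G := heawood) (l := (a :: (l ++ [a])).map vertexOf)
    (by simp) ((List.isChain_map vertexOf).2 hch) (a := vertexOf a) (b := vertexOf a) (by simp)
    (by simp)
  have hwl : w.length = (a :: l).length := by
    have := w.length_support
    rw [hw] at this
    simp at this
    simp [← this]
  have hcyc : w.IsCycle := by
    rw [SimpleGraph.Walk.isCycle_iff_isPath_tail_and_le_length]
    refine ⟨?_, by omega⟩
    rw [SimpleGraph.Walk.isPath_def, SimpleGraph.Walk.support_tail_of_not_nil _ (by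
      rw [SimpleGraph.Walk.not_nil_iff_lt_length]; omega), hw, List.map_cons, List.tail_cons]
    refine List.Nodup.map vertexOf_bijective.1 ?_
    exact (List.perm_append_singleton a l).nodup_iff.2 hnd
  refine ⟨w.toSubgraph, ⟨_, w, hcyc, hwl, rfl⟩, fun e => ?_⟩
  rw [HasEdge, SimpleGraph.Walk.adj_toSubgraph_iff_mem_edges, mem_edges_iff_mem_zip_support, hw,
    hbits, ← List.map_tail, List.zip_map]
  have hmem : ∀ (L : List (Fin 14 × Fin 14)) (x y : Fin 14),
      (vertexOf x, vertexOf y) ∈ L.map (Prod.map vertexOf vertexOf) ↔ (x, y) ∈ L := fun L x y =>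
    List.mem_map_of_injective (a := (x, y))
      (vertexOf_bijective.1.prodMap vertexOf_bijective.1)
  rw [hmem, hmem]

/-- The parity conditions put the code into the cycle space. Since a cycle is connected, the trace
meets all its edges and rebuilds the same subgraph, which gives the length `k`. -/
theorem exists_mem_cycleMasks {H : heawood.Subgraph} {k : ℕ} (hH : H ∈ kCycles heawood k) :
    ∃ m ∈ cycleMasks k, ∀ e : Fin 21, HasEdge H e ↔ m.testBit e = true := by
  classical
  obtain ⟨m, hm, hbits⟩ : ∃ m ∈ cycleSpace, ∀ e : Fin 21, HasEdge H e ↔ m.testBit e = true := by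
    let b : Fin 21 → Bool := fun e => decide (HasEdge H e)
    have hb : ∀ (x : Fin 14) (e₁ e₂ e₃ : Fin 21) (y₁ y₂ y₃ : Fin 14),
        (y₁ ≠ y₂ ∧ y₁ ≠ y₃ ∧ y₂ ≠ y₃) →
        (∀ y, heawood.Adj (vertexOf x) (vertexOf y) → y = y₁ ∨ y = y₂ ∨ y = y₃) →
        (HasEdge H e₁ ↔ H.Adj (vertexOf x) (vertexOf y₁)) →
        (HasEdge H e₂ ↔ H.Adj (vertexOf x) (vertexOf y₂)) →
        (HasEdge H e₃ ↔ H.Adj (vertexOf x) (vertexOf y₃)) → b e₁ = (b e₂ ^^ b e₃) := by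
      intro x e₁ e₂ e₃ y₁ y₂ y₃ hd hx h₁ h₂ h₃
      have inj := vertexOf_bijective.1
      have := parity_of_mem_kCycles hH (x := vertexOf x) (inj.ne hd.1) (inj.ne hd.2.1)
        (inj.ne hd.2.2) fun y hy => by
          obtain ⟨y, rfl⟩ := vertexOf_bijective.2 y
          rcases hx y hy with rfl | rfl | rfl <;> simp
      simpa only [b, h₁, h₂, h₃] using this
    -- The parity condition is used at every vertex except number 12. At the vertices `v j` the
    -- edges are stored in the opposite direction, hence `H.adj_comm`.
    have h := ofBits_mem_cycleSpace_of_parity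
      (b 0) (b 1) (b 2)
      (hb 0 2 0 1 9 7 13 (by decide +kernel) (by decide +kernel) .rfl .rfl .rfl)
      (b 3) (b 4) (b 5)
      (hb 1 5 3 4 10 8 7 (by decide +kernel) (by decide +kernel) .rfl .rfl .rfl)
      (b 17)
      (hb 7 17 0 4 5 0 1 (by decide +kernel)
        (by decide +kernel) (H.adj_comm ..) (H.adj_comm ..) (H.adj_comm ..))
      (b 6) (b 10)
      (hb 9 10 2 6 3 0 2 (by decide +kernel)
        (by decide +kernel) (H.adj_comm ..) (H.adj_comm ..) (H.adj_comm ..))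
      (b 7) (b 8)
      (hb 2 8 6 7 11 9 8 (by decide +kernel) (by decide +kernel) .rfl .rfl .rfl)
      (b 20)
      (hb 8 20 3 7 6 1 2 (by decide +kernel)
        (by decide +kernel) (H.adj_comm ..) (H.adj_comm ..) (H.adj_comm ..))
      (b 9) (b 11)
      (hb 3 11 9 10 12 10 9 (by decide +kernel) (by decide +kernel) .rfl .rfl .rfl)
      (b 13)
      (hb 10 13 5 9 4 1 3 (by decide +kernel)
        (by decide +kernel) (H.adj_comm ..) (H.adj_comm ..) (H.adj_comm ..))
      (b 12) (b 14)
      (hb 4 14 12 13 13 11 10 (by decide +kernel) (by decide +kernel) .rfl .rfl .rfl)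
      (b 16)
      (hb 11 16 8 12 5 2 4 (by decide +kernel)
        (by decide +kernel) (H.adj_comm ..) (H.adj_comm ..) (H.adj_comm ..))
      (b 18)
      (hb 13 18 1 14 6 0 4 (by decide +kernel)
        (by decide +kernel) (H.adj_comm ..) (H.adj_comm ..) (H.adj_comm ..))
      (b 15)
      (hb 5 15 16 17 12 11 7 (by decide +kernel) (by decide +kernel) .rfl .rfl .rfl)
      (b 19)
      (hb 6 19 18 20 12 13 8 (by decide +kernel) (by decide +kernel) .rfl .rfl .rfl)
    have hvec : b = ![b 0, b 1, b 2, b 3, b 4, b 5, b 6, b 7, b 8, b 9, b 10, b 11, b 12, b 13,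
        b 14, b 15, b 16, b 17, b 18, b 19, b 20] := by
      ext e
      fin_cases e <;> rfl
    refine ⟨_, h, fun e => ?_⟩
    rw [← hvec, Nat.testBit_ofBits_lt b e e.2, decide_eq_true_iff]
  obtain ⟨v, w, hw, hk, rfl⟩ := id hH
  have hadj : ∃ e, HasEdge w.toSubgraph e := by
    obtain ⟨y, hy⟩ := (mem_verts_iff_exists_adj_of_mem_kCycles hH v).1 w.start_mem_verts_toSubgraph
    obtain ⟨v, rfl⟩ := vertexOf_bijective.2 v
    obtain ⟨y, rfl⟩ := vertexOf_bijective.2 y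
    obtain ⟨e, he, -⟩ := exists_hasEdge_of_adj hy
    exact ⟨e, he⟩
  have hm0 : m ≠ 0 := by
    rintro rfl
    obtain ⟨e, he⟩ := hadj
    simpa using (hbits e).1 he
  obtain ⟨⟨e₀, he₀, hmem₀⟩, hclosed⟩ := traceCycle_closed m hm hm0
  let P : ZMod 7 ⊕ ZMod 7 → Prop := fun x => ∃ y ∈ traceCycle m, vertexOf y = x
  have hP : ∀ x, P (vertexOf x) ↔ x ∈ traceCycle m := fun x =>
    ⟨fun ⟨y, hy, e⟩ => vertexOf_bijective.1 e ▸ hy, fun h => ⟨x, h, rfl⟩⟩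
  have hsupp := iff_of_mem_support (P := P) w fun x y hxy => by
    rw [← SimpleGraph.Walk.adj_toSubgraph_iff_mem_edges] at hxy
    obtain ⟨x, rfl⟩ := vertexOf_bijective.2 x
    obtain ⟨y, rfl⟩ := vertexOf_bijective.2 y
    obtain ⟨e, he, ⟨rfl, rfl⟩ | ⟨rfl, rfl⟩⟩ := exists_hasEdge_of_adj hxy
    · rw [hP, hP, hclosed e ((hbits e).1 he)]
    · rw [hP, hP, hclosed e ((hbits e).1 he)]
  have hsrc : ∀ e, HasEdge w.toSubgraph e → vertexOf (edgeSrc e) ∈ w.support := fun e he =>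
    w.mem_verts_toSubgraph.1 (SimpleGraph.Subgraph.Adj.fst_mem he)
  have hall : ∀ e : Fin 21, m.testBit e = true → edgeSrc e ∈ traceCycle m := by
    intro e he
    rw [← hP, hsupp _ (hsrc e ((hbits e).2 he)), ← hsupp _ (hsrc e₀ ((hbits e₀).2 he₀)), hP]
    exact hmem₀
  obtain ⟨H', hH', hbits'⟩ := exists_kCycle_of_isTracedBy (isTracedBy_traceCycle m hm hm0 hall)
  have hHH' := eq_of_hasEdge_iff hH hH' fun e => (hbits e).trans (hbits' e).symm
  obtain ⟨v', w', hw', hk', rfl⟩ := hH'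
  refine ⟨m, mem_cycleMasks.2 ⟨hm, hm0, ?_, hall⟩, hbits⟩
  rw [← hk', ← hk, length_eq_of_toSubgraph_eq hw hw' hHH']

open Classical in
/-- The number of `k`-cycles through two edges. -/
theorem card_kCycles_hasEdge (k : ℕ) (e e' : Fin 21) :
    ((Set.toFinite (kCycles heawood k)).toFinset.filter
      fun H => HasEdge H e ∧ HasEdge H e').card =
      (cycleMasks k).countP fun m => m.testBit e && m.testBit e' := by
  have hnd : (cycleMasks k).Nodup := nodup_cycleSpace.filter _
  rw [List.countP_eq_length_filter, ← List.toFinset_card_of_nodup (hnd.filter _)]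
  choose! μ hμ hbits using fun (H : heawood.Subgraph) (hH : H ∈ kCycles heawood k) =>
    exists_mem_cycleMasks hH
  have hmem : ∀ {H : heawood.Subgraph}, H ∈ (Set.toFinite (kCycles heawood k)).toFinset.filter
      (fun H => HasEdge H e ∧ HasEdge H e') ↔
      H ∈ kCycles heawood k ∧ HasEdge H e ∧ HasEdge H e' := by
    simp
  refine Finset.card_bij (fun H _ => μ H) (fun H hH => ?_) (fun H hH H' hH' h => ?_)
    fun m hm => ?_
  · obtain ⟨h1, h2, h3⟩ := hmem.1 hH
    simp only [List.mem_toFinset, List.mem_filter, Bool.and_eq_true]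
    exact ⟨hμ H h1, (hbits H h1 e).1 h2, (hbits H h1 e').1 h3⟩
  · have h1 := (hmem.1 hH).1
    have h1' := (hmem.1 hH').1
    exact eq_of_hasEdge_iff h1 h1' fun a => by rw [hbits H h1, hbits H' h1', h]
  · simp only [List.mem_toFinset, List.mem_filter, Bool.and_eq_true] at hm
    obtain ⟨hm1, hm2, hm3⟩ := hm
    obtain ⟨hs, h0, hlen, hall⟩ := mem_cycleMasks.1 hm1
    obtain ⟨H, hH, hb⟩ := exists_kCycle_of_isTracedBy (isTracedBy_traceCycle m hs h0 hall)
    rw [hlen] at hH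
    refine ⟨H, hmem.2 ⟨hH, (hb e).2 hm2, (hb e').2 hm3⟩, ?_⟩
    refine eq_of_mem_cycleSpace (mem_cycleMasks.1 (hμ H hH)).1 hs fun a => ?_
    rw [Bool.eq_iff_iff, ← hbits H hH, hb]

end PlaneGraph

/-! ### Summation over the crossings -/

namespace PlaneGraph

open Set

theorem exists_heawood_edgePoint {x : Realization heawood} (hx : ¬ IsVertexPoint x) :
    ∃ e : Fin 21, ∃ s ∈ Ioo (0 : ℝ) 1, x = edgePoint (heawood_adj_edge e) s := by
  obtain ⟨u, v, h, s, hs, rfl⟩ := exists_edgePoint_of_not_isVertexPoint hx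
  obtain ⟨u, rfl⟩ := vertexOf_bijective.2 u
  obtain ⟨v, rfl⟩ := vertexOf_bijective.2 v
  obtain ⟨e, ⟨rfl, rfl⟩ | ⟨rfl, rfl⟩⟩ := exists_edge_of_heawood_adj u v h
  · exact ⟨e, s, hs, rfl⟩
  · obtain ⟨t, ht, e'⟩ := exists_edgePoint_symm h hs
    exact ⟨e, t, ht, e'⟩

theorem eq_of_heawood_edgePoint_eq {a b : Fin 21} {s t : ℝ} (hs : s ∈ Ioo (0 : ℝ) 1)
    (ht : t ∈ Icc (0 : ℝ) 1)
    (h : edgePoint (heawood_adj_edge a) s = edgePoint (heawood_adj_edge b) t) : a = b := by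
  have h' := congrArg Subtype.val h
  rw [edgePoint_val _ (Ioo_subset_Icc_self hs), edgePoint_val _ ht] at h'
  have inj := vertexOf_bijective.1
  rcases edgeMap_eq_imp (heawood_adj_edge a).ne hs h' with ⟨h1, h2⟩ | ⟨h1, -⟩
  · exact edge_ext a b (inj h1) (inj h2)
  · exact absurd (inj h1) (edgeSrc_ne_edgeTgt a b)

theorem IsFar.edgePoint_ne {a b : Fin 21} (h : IsFar a b) {s t : ℝ} (hs : s ∈ Icc (0 : ℝ) 1)
    (ht : t ∈ Icc (0 : ℝ) 1) :
    edgePoint (heawood_adj_edge a) s ≠ edgePoint (heawood_adj_edge b) t := by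
  intro he
  have inj := vertexOf_bijective.1
  refine edgeMap_ne_of_disjoint (heawood_adj_edge a).ne (inj.ne h.src_ne)
    (inj.ne (edgeSrc_ne_edgeTgt a b)) (inj.ne (edgeSrc_ne_edgeTgt b a).symm)
    (inj.ne h.tgt_ne) s t ?_
  rw [← edgePoint_val (heawood_adj_edge a) hs, he, edgePoint_val _ ht]

namespace IsPlaneGenericImmersion

variable {f : Realization heawood → Plane} (hf : IsPlaneGenericImmersion f)
include hf

/-- Every crossing lies on a unique unordered pair of edges. -/
theorem exists_edges_of_crossing {p : Plane} (hp : p ∈ crossings f (⊤ : heawood.Subgraph)) :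
    ∃ d : Fin 21 × Fin 21, d.1 ≤ d.2 ∧
      (∀ H : heawood.Subgraph, p ∈ crossings f H ↔ HasEdge H d.1 ∧ HasEdge H d.2) ∧
      ∀ a b, a < b → IsFar a b →
        (p ∈ edgeCrossings f (heawood_adj_edge a) (heawood_adj_edge b) ↔ d = (a, b)) := by
  obtain ⟨e, e', hle, s, hs, t, ht, hne, h1, h2⟩ : ∃ e e' : Fin 21, e ≤ e' ∧
      ∃ s ∈ Ioo (0 : ℝ) 1, ∃ t ∈ Ioo (0 : ℝ) 1,
        edgePoint (heawood_adj_edge e) s ≠ edgePoint (heawood_adj_edge e') t ∧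
        f (edgePoint (heawood_adj_edge e) s) = p ∧ f (edgePoint (heawood_adj_edge e') t) = p := by
    obtain ⟨x, -, y, -, hxy, hx, hy⟩ := hp
    obtain ⟨e, s, hs, rfl⟩ := exists_heawood_edgePoint
      (hf.not_vertex x y hxy (hx.trans hy.symm))
    obtain ⟨e', t, ht, rfl⟩ := exists_heawood_edgePoint
      (hf.not_vertex _ _ hxy.symm (hy.trans hx.symm))
    rcases le_total e e' with h | h
    · exact ⟨e, e', h, s, hs, t, ht, hxy, hx, hy⟩
    · exact ⟨e', e, h, t, ht, s, hs, hxy.symm, hy, hx⟩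
  have hcases : ∀ z, f z = p → z = edgePoint (heawood_adj_edge e) s ∨
      -- As there are no triple points, the two chosen points are the only preimages of `p`; every
      -- claim about `p` is decided on them.
      z = edgePoint (heawood_adj_edge e') t := by
    intro z hz
    rcases hf.double z _ _ (hz.trans h1.symm) (h1.trans h2.symm) with h | h | h
    exacts [.inl h, absurd h hne, .inr h]
  refine ⟨(e, e'), hle, fun H => ⟨?_, fun ⟨g1, g2⟩ => ?_⟩, fun a b hab hfar => ⟨?_, ?_⟩⟩
  · rintro ⟨x, hx, y, hy, hxy, ex, ey⟩
    have hboth : edgePoint (heawood_adj_edge e) s ∈ pointsOf H ∧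
        edgePoint (heawood_adj_edge e') t ∈ pointsOf H := by
      rcases hcases x ex with rfl | rfl <;> rcases hcases y ey with rfl | rfl
      exacts [absurd rfl hxy, ⟨hx, hy⟩, ⟨hy, hx⟩, absurd rfl hxy]
    rwa [mem_pointsOf_edgePoint _ hs, mem_pointsOf_edgePoint _ ht] at hboth
  · exact ⟨_, (mem_pointsOf_edgePoint _ hs H).2 g1, _, (mem_pointsOf_edgePoint _ ht H).2 g2, hne,
      h1, h2⟩
  · rintro ⟨s', hs', t', ht', ex, ey⟩
    have hst := hfar.edgePoint_ne hs' ht'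
    rcases hcases _ ex with gx | gx <;> rcases hcases _ ey with gy | gy
    · exact absurd (gx.trans gy.symm) hst
    · rw [eq_of_heawood_edgePoint_eq hs hs' gx.symm, eq_of_heawood_edgePoint_eq ht ht' gy.symm]
    · rw [← eq_of_heawood_edgePoint_eq hs ht' gy.symm,
        ← eq_of_heawood_edgePoint_eq ht hs' gx.symm] at hab
      exact absurd hab (not_lt.2 hle)
    · exact absurd (gx.trans gy.symm) hst
  · rintro ⟨⟩
    exact ⟨s, Ioo_subset_Icc_self hs, t, Ioo_subset_Icc_self ht, h1, h2⟩

/-- The sum of the crossing numbers of the `k`-cycles, as a sum over the crossings, and the parity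
of the number of crossings between edges at distance `2`. -/
theorem exists_crossing_pairs : ∃ (C : Finset Plane) (d : Plane → Fin 21 × Fin 21),
    Odd (C.filter fun p => IsFar (d p).1 (d p).2).card ∧
    ∀ k, sumCrossingNumber f k =
      ∑ p ∈ C, (cycleMasks k).countP fun m => m.testBit (d p).1 && m.testBit (d p).2 := by
  classical
  choose! d hle hcr hfar using fun p => hf.exists_edges_of_crossing (p := p)
  have hC : ∀ {p}, p ∈ hf.finite_crossings.toFinset ↔ p ∈ crossings f (⊤ : heawood.Subgraph) :=
    hf.finite_crossings.mem_toFinset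
  have hsub : ∀ H, crossings f H ⊆ crossings f (⊤ : heawood.Subgraph) := by
    rintro H p ⟨x, -, y, -, h⟩
    exact ⟨x, x.2, y, y.2, h⟩
  refine ⟨hf.finite_crossings.toFinset, d, ?_, fun k => ?_⟩
  · convert hf.odd_sum_farPairs using 1
    -- The crossings are sorted by their pair of edges; each fibre is the set of crossings of two
    -- fixed edges.
    rw [Finset.card_eq_sum_card_fiberwise (f := d) (t := farPairs)]
    · refine Finset.sum_congr rfl fun q hq => ?_
      obtain ⟨hlt, hq'⟩ := (Finset.mem_filter.1 hq).2
      rw [← Set.ncard_coe_finset]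
      congr 1
      ext p
      simp only [Finset.coe_filter, Finset.mem_filter, Set.mem_ofPred_eq, hC]
      constructor
      · rintro ⟨⟨hp, -⟩, rfl⟩
        exact (hfar p hp _ _ hlt hq').2 rfl
      · intro hp
        have hp' : p ∈ crossings f (⊤ : heawood.Subgraph) := by
          obtain ⟨s, hs, t, ht, ex, ey⟩ := hp
          exact ⟨_, (edgePoint _ s).2, _, (edgePoint _ t).2, hq'.edgePoint_ne hs ht, ex, ey⟩
        have hd := (hfar p hp' _ _ hlt hq').1 hp
        exact ⟨⟨hp', by rw [hd]; exact hq'⟩, hd⟩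
    · intro p hp
      obtain ⟨hp, hfp⟩ := Finset.mem_filter.1 hp
      refine Finset.mem_coe.2 (Finset.mem_filter.2 ⟨Finset.mem_univ _, ?_, hfp⟩)
      refine lt_of_le_of_ne (hle p (hC.1 hp)) fun h => ?_
      rw [h] at hfp
      exact hfp.src_ne rfl
  · have h1 : ∀ H : heawood.Subgraph, crossingNumber f H =
        ∑ p ∈ hf.finite_crossings.toFinset, if p ∈ crossings f H then 1 else 0 := by
      intro H
      rw [crossingNumber, ← Finset.card_filter, ← Set.ncard_coe_finset]
      congr 1
      ext p
      simp only [Finset.coe_filter, Set.mem_ofPred_eq, hC]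
      exact ⟨fun h => ⟨hsub H h, h⟩, fun h => h.2⟩
    -- Exchanging the sums over cycles and crossings is the double count.
    rw [sumCrossingNumber, Finset.sum_congr rfl fun H _ => h1 H, Finset.sum_comm]
    refine Finset.sum_congr rfl fun p hp => ?_
    rw [← card_kCycles_hasEdge, Finset.card_filter]
    refine Finset.sum_congr rfl fun H _ => ?_
    simp only [hcr p (hC.1 hp) H]

theorem odd_sumCrossingNumber {k : ℕ} (hk : k ∈ [6, 8, 10]) :
    sumCrossingNumber f k ≡ 1 [MOD 2] := by
  obtain ⟨C, d, hodd, hsum⟩ := hf.exists_crossing_pairs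
  rw [hsum, ← Nat.odd_iff.1 hodd, Finset.card_filter, Nat.ModEq, Nat.mod_mod,
    Finset.sum_nat_mod, Finset.sum_congr rfl fun p _ => countP_cycleMasks_odd k hk (d p).1 (d p).2]

end IsPlaneGenericImmersion

end PlaneGraph

theorem theorem1p9 (f : PlaneGraph.Realization PlaneGraph.heawood → PlaneGraph.Plane)
    (hf : PlaneGraph.IsPlaneGenericImmersion f) :
    PlaneGraph.sumCrossingNumber f 6 ≡ 1 [MOD 2] ∧
    PlaneGraph.sumCrossingNumber f 8 ≡ 1 [MOD 2] ∧
    PlaneGraph.sumCrossingNumber f 10 ≡ 1 [MOD 2] ∧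
    PlaneGraph.sumCrossingNumber f 12 ≡ 0 [MOD 4] ∧
    PlaneGraph.sumCrossingNumber f 14 ≡ 0 [MOD 2] := by
  refine ⟨hf.odd_sumCrossingNumber (by simp), hf.odd_sumCrossingNumber (by simp),
    hf.odd_sumCrossingNumber (by simp), ?_, ?_⟩
  all_goals
    obtain ⟨C, d, -, hsum⟩ := hf.exists_crossing_pairs
    rw [hsum, Nat.modEq_zero_iff_dvd]
    refine Finset.dvd_sum fun p _ => Nat.dvd_of_mod_eq_zero ?_
  · exact PlaneGraph.countP_cycleMasks_twelve _ _
  · exact PlaneGraph.countP_cycleMasks_fourteen _ _
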